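/- For $n\ge 0$, a constant $Z\in\mathbb R\setminus\{0\}$ and functions $f_1,\dots,f_n:\mathbb R\to\mathbb R$ such that the integrals $\int_{-\infty}^{\infty}x^{j-1}f_k(x)\,dx$ converge absolutely for all $j,k=1,\dots,n$, put $$\mathcal P_{f,Z}(x_1,\dots,x_n)=\frac1{Z}\,\Delta_n(x)\,\det\bigl[f_k(x_j)\bigr]_{j,k=1}^n,\qquad \Delta_n(x)=\prod_{j<k}(x_k-x_j).$$ We say that the eigenvalues of a random Hermitian $n\times n$ matrix are a polynomial ensemble with functions $f_1,\dots,f_n$ if these integrals converge absolutely and, for some $Z\neq0$, $\mathcal P_{f,Z}$ is non-negative on all of $\mathbb R^n$, has integral $1$, and is the joint density of the unordered eigenvalues (the eigenvalues, with multiplicity, listed in uniformly random order). Let $\operatorname{Re}v_j,\operatorname{Im}v_j$, $j=1,\dots,n$, be mutually independent normal random variables with mean zero and variance $1/2$, and let $X$ be a random Hermitian $n\times n$ matrix, independent of $v=(v_1,\dots,v_n)^t$, whose eigenvalues are a polynomial ensemble with functions $f_1,\dots,f_n$. Then for every $k$ and every $y\in\mathbb R$ the integral $$g_k(y)=\int_0^\infty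 e^{-x}f_k(y-x)\,dx$$ converges absolutely, and the eigenvalues of $Y=X+vv^*$ are a polynomial ensemble with functions $g_1,\dots,g_n$; that is, for some constant $\tilde Z_n\ne0$, their joint density is $$\frac1{\tilde Z_n}\,\Delta_n(y)\,\det\bigl[g_k(y_j)\bigr]_{j,k=1}^n .$$ -/

import Mathlib

open MeasureTheory ProbabilityTheory
open scoped NNReal ENNReal

noncomputable section

/-- The Vandermonde product `Δ_n(x) = ∏_{j < k} (x_k - x_j)`. -/
def vandermondeProd {n : ℕ} (x : Fin n → ℝ) : ℝ :=
  ∏ j : Fin n, ∏ k ∈ Finset.Ioi j, (x k - x j)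

/-- The function `x ↦ (1 / Z) Δ_n(x) det [f_k(x_j)]_{j,k}` on `ℝⁿ`. -/
def polyEnsembleDensity {n : ℕ} (f : Fin n → ℝ → ℝ) (Z : ℝ) (x : Fin n → ℝ) : ℝ :=
  1 / Z * vandermondeProd x * (Matrix.of fun j k : Fin n => f k (x j)).det

/-- The functions `f_1, …, f_n` and the constant `Z` define a polynomial ensemble: the moments
`∫ x^{j-1} f_k(x) dx`, `1 ≤ j, k ≤ n`, converge absolutely, and
`(1 / Z) Δ_n(x) det [f_k(x_j)]` is a probability density on `ℝⁿ`. The last field forces `Z ≠ 0` and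
the linear independence of the `f_k`. -/
structure IsPolynomialEnsemble {n : ℕ} (f : Fin n → ℝ → ℝ) (Z : ℝ) : Prop where
  integrable_moment : ∀ j k : Fin n, Integrable (fun x : ℝ => x ^ (j : ℕ) * f k x)
  nonneg : ∀ x : Fin n → ℝ, 0 ≤ polyEnsembleDensity f Z x
  lintegral_eq_one : ∫⁻ x : Fin n → ℝ, ENNReal.ofReal (polyEnsembleDensity f Z x) = 1

/-- The law of the randomly relabelled coordinates: `(1 / n!) ∑_σ` of the images of `ν` under the
coordinate permutations. -/
def symmetrizedLaw {n : ℕ} (ν : Measure (Fin n → ℝ)) : Measure (Fin n → ℝ) :=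
  ((n.factorial : ℝ≥0∞)⁻¹) • ∑ σ : Equiv.Perm (Fin n), ν.map (fun x => x ∘ σ)

/-- The joint law on `ℝⁿ` of the unordered eigenvalues (with multiplicity) of a random Hermitian
matrix, that is, of the eigenvalues listed in a uniformly random order. -/
def unorderedEigenvalueLaw {Ω : Type*} [MeasurableSpace Ω] (μ : Measure Ω) {n : ℕ}
    (M : Ω → Matrix (Fin n) (Fin n) ℂ) (hM : ∀ ω, (M ω).IsHermitian) : Measure (Fin n → ℝ) :=
  symmetrizedLaw (μ.map fun ω => (hM ω).eigenvalues)

/-- The eigenvalues of the random Hermitian matrix `M` are a polynomial ensemble with functions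
`f_1, …, f_n`. -/
def EigenvaluesArePolynomialEnsemble {Ω : Type*} [MeasurableSpace Ω] (μ : Measure Ω) {n : ℕ}
    (M : Ω → Matrix (Fin n) (Fin n) ℂ) (hM : ∀ ω, (M ω).IsHermitian)
    (f : Fin n → ℝ → ℝ) : Prop :=
  ∃ Z : ℝ, IsPolynomialEnsemble f Z ∧
    unorderedEigenvalueLaw μ M hM =
      (volume : Measure (Fin n → ℝ)).withDensity
        fun x => ENNReal.ofReal (polyEnsembleDensity f Z x)

/-- The rank one modification `A + v v*`. -/
def rankOneModification {n : ℕ} (A : Matrix (Fin n) (Fin n) ℂ) (v : Fin n → ℂ) :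
    Matrix (Fin n) (Fin n) ℂ :=
  A + Matrix.vecMulVec v (star v)

theorem isHermitian_rankOneModification {n : ℕ} {A : Matrix (Fin n) (Fin n) ℂ}
    (hA : A.IsHermitian) (v : Fin n → ℂ) : (rankOneModification A v).IsHermitian := by
  refine hA.add ?_
  ext i j
  simp [Matrix.vecMulVec_apply, mul_comm]

end

noncomputable section

/-! Condition on `X`. Its spectrum is almost surely simple and the law of `v` is unitarily
invariant, so `X` may be replaced by diag(x) with x strictly increasing. Evaluating the
characteristic polynomial of diag(x) + vv* at x_j gives ∏_k (y_k - x_j) = |v_j|² ∏_{k≠j} (x_k -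
x_j). Hence the weights w_j = |v_j|² and the increasingly ordered eigenvalues y determine each
other, and a sign count shows that all w_j are positive exactly when x_1 < y_1 < x_2 < … < x_n < y_n
(`image_interlacingWeights`).

The w_j are independent standard exponential variables, the Jacobian of y ↦ w has absolute value
Δ(y)/Δ(x), and the trace gives Σw = Σy - Σx. So, given x, the ordered y has density Δ(y)/Δ(x) ·
exp(-(Σy - Σx)) on the interlacing set. For increasing y the indicator of that set is almost
everywhere det[1_{x_i < y_j}], and the exponential can be absorbed into rows and columns. With e the
exponential density, the unordered eigenvalues thus have conditional density (1/n!) Δ(y)/Δ(x)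
det[e(y_j - x_i)] (`lintegral_eigenvalues_rankOneModification`).

Multiplying by the density of the spectrum of `X` cancels Δ(x), and Andréief's identity integrates x
out, turning det[e(y_j - x_i)] det[f_k(x_i)] into n! det[g_k(y_j)]. The same constant `Z` therefore
serves for `Y`. Non-negativity is inherited from the integrand, and the total mass is 1 because the
density is that of a probability law. -/

/-! ### Vandermonde products, interlacing and determinants of step functions -/

lemma vandermondeProd_eq_det {n : ℕ} (x : Fin n → ℝ) :
    vandermondeProd x = (Matrix.vandermonde x).det := (Matrix.det_vandermonde x).symm

lemma vandermondeProd_comp_perm {n : ℕ} (x : Fin n → ℝ) (σ : Equiv.Perm (Fin n)) :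
    vandermondeProd (x ∘ σ) = (Equiv.Perm.sign σ : ℤ) * vandermondeProd x := by
  rw [vandermondeProd_eq_det, vandermondeProd_eq_det, ← Matrix.det_permute]
  rfl

lemma vandermondeProd_ne_zero_iff {n : ℕ} {x : Fin n → ℝ} :
    vandermondeProd x ≠ 0 ↔ Function.Injective x := by
  rw [vandermondeProd_eq_det, Matrix.det_vandermonde_ne_zero_iff]

lemma vandermondeProd_pos {n : ℕ} {x : Fin n → ℝ} (hx : StrictMono x) :
    0 < vandermondeProd x :=
  Finset.prod_pos fun _ _ => Finset.prod_pos fun _ hk =>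
    sub_pos.2 (hx (Finset.mem_Ioi.1 hk))

/-- The set of `y` with `x_1 < y_1 < x_2 < y_2 < … < x_n < y_n`. -/
def interlacingSet {n : ℕ} (x : Fin n → ℝ) : Set (Fin n → ℝ) :=
  {y | (∀ i, x i < y i) ∧ ∀ i j, i < j → y i < x j}

lemma interlacingSet.strictMono {n : ℕ} {x y : Fin n → ℝ} (hy : y ∈ interlacingSet x) :
    StrictMono y := fun i j hij => (hy.2 i j hij).trans (hy.1 j)

lemma exists_strictMono_comp_perm {n : ℕ} {x : Fin n → ℝ} (hx : Function.Injective x) :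
    ∃ σ : Equiv.Perm (Fin n), StrictMono (x ∘ σ) :=
  ⟨Tuple.sort x, (Tuple.monotone_sort x).strictMono_of_injective
    (hx.comp (Tuple.sort x).injective)⟩

lemma strictMono_eq_of_pos_of_le {n : ℕ} {N : Fin n → ℕ} (hN : StrictMono N)
    (h0 : ∀ i, 0 < N i) (hn : ∀ i, N i ≤ n) (i : Fin n) : N i = i + 1 := by
  have h1 : ∀ k : ℕ, ∀ hk : k < n, k + 1 ≤ N ⟨k, hk⟩ := by
    intro k
    induction k with
    | zero => exact fun hk => h0 _
    | succ k ih =>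
      intro hk
      have := ih (by omega)
      have h2 : N ⟨k, by omega⟩ < N ⟨k + 1, hk⟩ := hN (by simp [Fin.lt_def])
      omega
  have h2 : ∀ d : ℕ, ∀ k : ℕ, ∀ hk : k < n, k + d + 1 = n → N ⟨k, hk⟩ + d ≤ n := by
    intro d
    induction d with
    | zero => exact fun k hk _ => hn _
    | succ d ih =>
      intro k hk hkd
      have := ih (k + 1) (by omega) (by omega)
      have h2 : N ⟨k, hk⟩ < N ⟨k + 1, by omega⟩ := hN (by simp [Fin.lt_def])
      omega
  have a := h1 i i.2
  have b := h2 (n - 1 - i) i i.2 (by omega)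
  simp only [Fin.eta] at a b
  omega

/-- Column j depends only on the number N_j of x_i below y_j. A vanishing N_j gives a zero column
and a repeated value gives equal columns. Otherwise N is strictly increasing in {1, …, n}, so N_j =
j + 1 (zero-based j), which is interlacing, and the matrix is upper triangular with unit diagonal.
-/
lemma det_step {n : ℕ} {x y : Fin n → ℝ} (hx : StrictMono x) (hy : StrictMono y) :
    (Matrix.of fun i j : Fin n => if x i < y j then (1 : ℝ) else 0).det =
      if (∀ i, x i < y i) ∧ ∀ i j, i < j → y i ≤ x j then 1 else 0 := by
  split_ifs with h
  · rw [Matrix.det_of_isUpperTriangular]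
    · simp [h.1]
    · intro i j hij
      simp only [id_eq] at hij
      simp [h.2 j i hij]
  · let N : Fin n → ℕ := fun j => (Finset.univ.filter fun i => x i < y j).card
    have key : ∀ i j, x i < y j ↔ (i : ℕ) < N j := fun i j =>
      (Tuple.lt_card_lt_iff_apply_lt_of_monotone (j := i) (a := y j) hx.monotone).symm
    by_cases h0 : ∃ j, N j = 0
    · obtain ⟨j, hj⟩ := h0
      refine Matrix.det_eq_zero_of_column_eq_zero j fun i => ?_
      simp [key, hj]
    · push Not at h0
      have hmono : Monotone N := fun i j hij =>
        Finset.card_le_card fun k hk => by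
          simp only [Finset.mem_filter, Finset.mem_univ, true_and] at hk ⊢
          exact hk.trans_le (hy.monotone hij)
      by_cases hinj : Function.Injective N
      · exfalso
        have hN := strictMono_eq_of_pos_of_le (hmono.strictMono_of_injective hinj)
          (fun i => Nat.pos_of_ne_zero (h0 i))
          (fun i => (Finset.card_le_univ _).trans (by simp))
        refine h ⟨fun i => (key i i).2 (by rw [hN]; omega), fun i j hij => ?_⟩
        rw [← not_lt, key, hN]
        rw [Fin.lt_def] at hij
        omega
      · simp only [Function.Injective, not_forall] at hinj
        obtain ⟨i, j, hij, hne⟩ := hinj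
        refine Matrix.det_zero_of_column_eq hne fun k => ?_
        simp [key, hij]

/-! ### The transition density -/

/-- The density of the standard exponential distribution, as a convolution kernel. -/
def expKernel (t : ℝ) : ℝ := if 0 < t then Real.exp (-t) else 0

/-- The conditional density (up to a factor `n!`) of the eigenvalues `y` of the rank one
modification, given the eigenvalues `x` of the original matrix. -/
def transitionDensity {n : ℕ} (x y : Fin n → ℝ) : ℝ :=
  vandermondeProd y / vandermondeProd x *
    (Matrix.of fun i j : Fin n => expKernel (y j - x i)).det

lemma det_expKernel {n : ℕ} (x y : Fin n → ℝ) :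
    (Matrix.of fun i j : Fin n => expKernel (y j - x i)).det =
      Real.exp (-(∑ i, y i - ∑ i, x i)) *
        (Matrix.of fun i j : Fin n => if x i < y j then (1 : ℝ) else 0).det := by
  have : (Matrix.of fun i j : Fin n => expKernel (y j - x i)) =
      Matrix.of fun i j => Real.exp (-y j) * (Matrix.of fun i j => Real.exp (x i) *
        (Matrix.of fun i j : Fin n => if x i < y j then (1 : ℝ) else 0) i j) i j := by
    ext i j
    simp only [Matrix.of_apply, expKernel, sub_pos]
    split_ifs
    · rw [mul_one, ← Real.exp_add]; congr 1; ring
    · simp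
  rw [this, Matrix.det_mul_row, Matrix.det_mul_column, ← mul_assoc, ← Real.exp_sum,
    ← Real.exp_sum, ← Real.exp_add]
  congr 2
  simp; ring

lemma transitionDensity_comp_left {n : ℕ} (x y : Fin n → ℝ) (σ : Equiv.Perm (Fin n)) :
    transitionDensity (x ∘ σ) y = transitionDensity x y := by
  have h := Matrix.det_permute σ (Matrix.of fun i j : Fin n => expKernel (y j - x i))
  have h' : (Matrix.of fun i j : Fin n => expKernel (y j - (x ∘ σ) i)) =
    (Matrix.of fun i j : Fin n => expKernel (y j - x i)).submatrix σ id := rfl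
  rw [transitionDensity, transitionDensity, vandermondeProd_comp_perm, h', h]
  rcases Int.units_eq_one_or (Equiv.Perm.sign σ) with hs | hs <;> simp [hs, div_neg]

lemma transitionDensity_comp_right {n : ℕ} (x y : Fin n → ℝ) (σ : Equiv.Perm (Fin n)) :
    transitionDensity x (y ∘ σ) = transitionDensity x y := by
  have h := Matrix.det_permute' σ (Matrix.of fun i j : Fin n => expKernel (y j - x i))
  have h' : (Matrix.of fun i j : Fin n => expKernel ((y ∘ σ) j - x i)) =
    (Matrix.of fun i j : Fin n => expKernel (y j - x i)).submatrix id σ := rfl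
  rw [transitionDensity, transitionDensity, vandermondeProd_comp_perm, h', h]
  rcases Int.units_eq_one_or (Equiv.Perm.sign σ) with hs | hs <;> simp [hs, neg_div]

lemma transitionDensity_nonneg {n : ℕ} {x : Fin n → ℝ} (hx : Function.Injective x)
    (y : Fin n → ℝ) : 0 ≤ transitionDensity x y := by
  by_cases hy : Function.Injective y
  · obtain ⟨σ, hσ⟩ := exists_strictMono_comp_perm hx
    obtain ⟨τ, hτ⟩ := exists_strictMono_comp_perm hy
    rw [← transitionDensity_comp_left x y σ, ← transitionDensity_comp_right _ y τ,
      transitionDensity, det_expKernel, det_step hσ hτ]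
    have := vandermondeProd_pos hσ
    have := vandermondeProd_pos hτ
    split_ifs <;> positivity
  · have : vandermondeProd y = 0 := by
      by_contra h
      exact hy (vandermondeProd_ne_zero_iff.1 h)
    simp [transitionDensity, this]

open Classical in
-- At most one ordering of y can interlace with x, namely the increasing one, so the sum has a
-- single possibly nonzero term. The assumption y_i ≠ x_j turns the weak inequalities of `det_step`
-- into strict ones.
lemma transitionDensity_eq_sum {n : ℕ} {x : Fin n → ℝ} (hx : StrictMono x) {y : Fin n → ℝ}
    (hy : Function.Injective y) (hxy : ∀ i j, y i ≠ x j) :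
    transitionDensity x y = ∑ σ : Equiv.Perm (Fin n),
      (interlacingSet x).indicator (fun z => vandermondeProd z / vandermondeProd x *
        Real.exp (-(∑ i, z i - ∑ i, x i))) (y ∘ σ) := by
  obtain ⟨τ, hτ⟩ := exists_strictMono_comp_perm hy
  rw [Finset.sum_eq_single τ]
  · rw [← transitionDensity_comp_right _ y τ, transitionDensity, det_expKernel, det_step hx hτ,
      Set.indicator_apply]
    have : ((∀ i, x i < (y ∘ τ) i) ∧ ∀ i j, i < j → (y ∘ τ) i ≤ x j) ↔
        y ∘ τ ∈ interlacingSet x :=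
      and_congr_right fun _ => forall₃_congr fun i j _ =>
        ⟨fun h => lt_of_le_of_ne h (hxy _ _), le_of_lt⟩
    rw [← mul_assoc]
    simp only [this]
    split_ifs <;> simp
  · intro σ _ hne
    refine Set.indicator_of_notMem (fun h => hne ?_) _
    have := Tuple.unique_monotone (interlacingSet.strictMono h).monotone hτ.monotone
    ext i
    exact congrArg Fin.val (hy (congrFun this i))
  · simp

/-! ### Weights as coordinates on the interlacing set -/

open Polynomial in
lemma exists_perm_of_prod_X_sub_C_eq {n : ℕ} {a b : Fin n → ℝ}
    (h : ∏ i, (X - C (a i)) = ∏ i, (X - C (b i))) : ∃ σ : Equiv.Perm (Fin n), b = a ∘ σ := by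
  have hroots : ∀ c : Fin n → ℝ,
      (∏ i, (X - C (c i))).roots = Multiset.map c Finset.univ.val := fun c => by
    rw [Polynomial.roots_prod]
    · simp
    · simp [Finset.prod_ne_zero_iff, Polynomial.X_sub_C_ne_zero]
  have hm : Multiset.map a Finset.univ.val = Multiset.map b Finset.univ.val := by
    rw [← hroots, ← hroots, h]
  rw [Fin.univ_val_map, Fin.univ_val_map, Multiset.coe_eq_coe] at hm
  have hs : a ∘ Tuple.sort a = b ∘ Tuple.sort b := List.ofFn_injective <|
    ((((Tuple.sort a).ofFn_comp_perm a).trans hm).trans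
      ((Tuple.sort b).ofFn_comp_perm b).symm).eq_of_pairwise'
      (Tuple.monotone_sort a).sortedLE_ofFn.pairwise (Tuple.monotone_sort b).sortedLE_ofFn.pairwise
  refine ⟨(Tuple.sort b).symm.trans (Tuple.sort a), ?_⟩
  ext i
  have := congrFun hs ((Tuple.sort b).symm i)
  simp at this
  simp [this]

open Polynomial in
-- Two monic polynomials of degree n that agree at n distinct points coincide, hence have the same
-- multiset of roots.
lemma exists_perm_of_prod_sub_eq {n : ℕ} {a b x : Fin n → ℝ} (hx : Function.Injective x)
    (h : ∀ j, ∏ i, (a i - x j) = ∏ i, (b i - x j)) :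
    ∃ σ : Equiv.Perm (Fin n), b = a ∘ σ := by
  have hmonic : ∀ c : Fin n → ℝ, (∏ i, (X - C (c i))).Monic := fun c =>
    Polynomial.monic_prod_of_monic _ _ fun i _ => Polynomial.monic_X_sub_C _
  have hdeg : ∀ c : Fin n → ℝ, (∏ i, (X - C (c i))).degree = (n : WithBot ℕ) := fun c => by
    simp [Polynomial.degree_prod]
  refine exists_perm_of_prod_X_sub_C_eq (Polynomial.eq_of_degree_le_of_eval_finset_eq
    (Finset.univ.image x) ?_ ?_ ?_ ?_)
  · simp [Finset.card_image_of_injective _ hx, hdeg]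
  · rw [hdeg, hdeg]
  · rw [(hmonic a).leadingCoeff, (hmonic b).leadingCoeff]
  · intro t ht
    obtain ⟨j, -, rfl⟩ := Finset.mem_image.1 ht
    have e : ∀ c : Fin n → ℝ, (∏ i, (X - C (c i))).eval (x j) =
        (-1) ^ n * ∏ i, (c i - x j) := fun c => by
      have := Finset.prod_const (s := (Finset.univ : Finset (Fin n))) (-1 : ℝ)
      rw [Finset.card_fin] at this
      rw [Polynomial.eval_prod, ← this, ← Finset.prod_mul_distrib]
      simp
    rw [e, e, h]

/-- The weights `w` for which the rank one modification of `diag x` by `√w` has eigenvalues `y`. -/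
def interlacingWeights {n : ℕ} (x y : Fin n → ℝ) (j : Fin n) : ℝ :=
  (∏ k, (y k - x j)) / ∏ k ∈ {j}ᶜ, (x k - x j)

lemma prod_compl_sub_ne_zero {n : ℕ} {x : Fin n → ℝ} (hx : Function.Injective x) (j : Fin n) :
    ∏ k ∈ {j}ᶜ, (x k - x j) ≠ 0 := by
  refine Finset.prod_ne_zero_iff.2 fun k hk => sub_ne_zero.2 fun h => ?_
  simp [hx h] at hk

lemma interlacingWeights_injOn {n : ℕ} {x : Fin n → ℝ} (hx : Function.Injective x) :
    Set.InjOn (interlacingWeights x) (interlacingSet x) := by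
  intro y hy z hz h
  obtain ⟨σ, rfl⟩ := exists_perm_of_prod_sub_eq (a := y) (b := z) hx fun j =>
    (div_left_inj' (prod_compl_sub_ne_zero hx j)).1 (congrFun h j)
  exact Tuple.unique_monotone (σ := 1) (interlacingSet.strictMono hy).monotone
    (interlacingSet.strictMono hz).monotone

lemma neg_one_pow_card_mul_prod_pos {ι : Type*} (s : Finset ι) (c : ι → ℝ)
    (hc : ∀ k ∈ s, c k ≠ 0) : 0 < (-1) ^ (s.filter fun k => c k < 0).card * ∏ k ∈ s, c k := by
  classical
  induction s using Finset.induction_on with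
  | empty => simp
  | insert a s ha ih =>
    have ih := ih fun k hk => hc k (Finset.mem_insert_of_mem hk)
    rw [Finset.prod_insert ha, Finset.filter_insert]
    split_ifs with h
    · rw [Finset.card_insert_of_notMem (by simp [ha]), pow_succ]
      nlinarith
    · have : 0 < c a := lt_of_le_of_ne (not_lt.1 h) (hc a (Finset.mem_insert_self _ _)).symm
      nlinarith

/-- The exponent counts negative factors: those of the numerator are the y_k below x_j, and those of
the denominator are the x_k below x_j, of which there are exactly j (zero-based). -/
lemma interlacingWeights_sign {n : ℕ} {x y : Fin n → ℝ} (hx : StrictMono x) (j : Fin n)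
    (hy : ∀ k, y k ≠ x j) :
    0 < (-1) ^ ((Finset.univ.filter fun k => y k < x j).card + j) * interlacingWeights x y j := by
  have h1 := neg_one_pow_card_mul_prod_pos Finset.univ (fun k => y k - x j)
    fun k _ => sub_ne_zero.2 (hy k)
  have h2 := neg_one_pow_card_mul_prod_pos {j}ᶜ (fun k => x k - x j)
    fun k hk => sub_ne_zero.2 fun h => by simp [hx.injective h] at hk
  simp only [sub_neg] at h1 h2
  have h3 : (({j}ᶜ : Finset (Fin n)).filter fun k => x k < x j).card = j := by
    rw [← Fin.card_Iio j]
    congr 1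
    ext k
    simp only [hx.lt_iff_lt, Finset.mem_filter, Finset.mem_compl, Finset.mem_singleton,
      Finset.mem_Iio]
    exact ⟨fun h => h.2, fun h => ⟨h.ne, h⟩⟩
  rw [h3] at h2
  have := div_pos h1 h2
  rw [mul_div_mul_comm] at this
  rwa [div_eq_mul_inv, ← inv_pow, inv_neg_one, ← pow_add] at this

lemma interlacingWeights_pos {n : ℕ} {x y : Fin n → ℝ} (hx : StrictMono x)
    (hy : y ∈ interlacingSet x) (j : Fin n) : 0 < interlacingWeights x y j := by
  have hlt : ∀ k, y k < x j ↔ k < j := fun k =>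
    ⟨fun h => by
      by_contra hk
      exact absurd ((hx.monotone (not_lt.1 hk)).trans_lt (hy.1 k)) h.asymm, hy.2 k j⟩
  have h := interlacingWeights_sign (y := y) hx j fun k hk => by
    rcases lt_or_ge k j with h | h
    · exact (hy.2 k j h).ne hk
    · exact ((hx.monotone h).trans_lt (hy.1 k)).ne' hk
  have hc : (Finset.univ.filter fun k => y k < x j).card = j := by
    simp only [hlt]
    rw [← Fin.card_Iio j]
    congr 1
    ext k
    simp
  rw [hc, ← two_mul, pow_mul] at h
  simpa using h

/-- A parity argument: positivity forces the number N_j of y_k below x_j to have the parity of j. As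
N is monotone with values in {0, …, n}, this leaves only N_j = j, which is interlacing. -/
lemma mem_interlacingSet_of_pos {n : ℕ} {x y : Fin n → ℝ} (hx : StrictMono x) (hy : Monotone y)
    (h : ∀ j, 0 < interlacingWeights x y j) : y ∈ interlacingSet x := by
  have hne : ∀ j k, y k ≠ x j := fun j k hk => (h j).ne' <| by
    rw [interlacingWeights, Finset.prod_eq_zero (Finset.mem_univ k) (sub_eq_zero.2 hk), zero_div]
  let N : Fin n → ℕ := fun j => (Finset.univ.filter fun k => y k < x j).card
  have key : ∀ k j, y k < x j ↔ (k : ℕ) < N j := fun k j =>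
    (Tuple.lt_card_lt_iff_apply_lt_of_monotone (j := k) (a := x j) hy).symm
  have heven : ∀ j, Even (N j + j) := fun j => by
    by_contra ho
    have := interlacingWeights_sign hx j (hne j)
    rw [(Nat.not_even_iff_odd.1 ho).neg_one_pow] at this
    linarith [h j]
  have hmono : Monotone N := fun i j hij => Finset.card_le_card fun k hk => by
    simp only [Finset.mem_filter, Finset.mem_univ, true_and] at hk ⊢
    exact hk.trans_le (hx.monotone hij)
  have hle : ∀ j, N j ≤ n := fun j => (Finset.card_le_univ _).trans (by simp)
  have hN : ∀ j, N j = j := by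
    clear_value N
    cases n with
    | zero => exact fun j => j.elim0
    | succ m =>
      -- Neighbouring values have opposite parities, so the monotone N cannot repeat a value.
      have hs : StrictMono N := Fin.strictMono_iff_lt_succ.2 fun i => by
        have h1 := heven i.castSucc
        have h2 := heven i.succ
        have h3 := hmono (Fin.castSucc_le_succ i)
        rcases h3.lt_or_eq with h3 | h3
        · exact h3
        · rw [← h3] at h2
          simp only [Fin.val_castSucc, Fin.val_succ] at h1 h2
          rw [← add_assoc] at h2
          exact absurd h1 (Nat.even_add_one.1 h2)
      -- The only larger value allowed is m + 1, which has the wrong parity.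
      have hlast : N (Fin.last m) ≤ m := by
        have h1 := heven (Fin.last m)
        have h2 := hle (Fin.last m)
        rcases h2.lt_or_eq with h2 | h2
        · omega
        · rw [h2, Fin.val_last] at h1
          exfalso
          rcases h1 with ⟨r, hr⟩
          omega
      intro j
      have := strictMono_eq_of_pos_of_le (N := fun j => N j + 1)
        (fun i j hij => Nat.add_lt_add_right (hs hij) 1) (fun _ => Nat.succ_pos _)
        (fun i => Nat.succ_le_succ ((hmono (Fin.le_last i)).trans hlast)) j
      simpa using this
  refine ⟨fun i => lt_of_le_of_ne (not_lt.1 fun hi => ?_) (hne i i).symm, fun i j hij => ?_⟩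
  · rw [key, hN] at hi
    exact lt_irrefl _ hi
  · rw [key, hN]
    exact hij

/-! ### Spectrum of a rank one modification of a diagonal matrix -/

/-- The matrix determinant lemma without division, as it will be used with a vanishing diagonal
entry. For invertible diagonal, factor it out; the general case follows by continuity after shifting
the diagonal by e, which is invertible for all but finitely many e. -/
lemma det_diagonal_add_vecMulVec {n : ℕ} (d u w : Fin n → ℂ) :
    (Matrix.diagonal d + Matrix.vecMulVec u w).det =
      ∏ i, d i + ∑ i, u i * w i * ∏ k ∈ {i}ᶜ, d k := by
  let F : ℂ → ℂ := fun e =>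
    (Matrix.diagonal (fun i => d i + e) + Matrix.vecMulVec u w).det
  let G : ℂ → ℂ := fun e =>
    ∏ i, (d i + e) + ∑ i, u i * w i * ∏ k ∈ {i}ᶜ, (d k + e)
  have hF : Continuous F := Continuous.matrix_det <|
    (Continuous.matrix_diagonal (by fun_prop)).add continuous_const
  have hG : Continuous G := by fun_prop
  have hfin : (⋃ i, {-d i} : Set ℂ).Finite := Set.finite_iUnion fun i => Set.finite_singleton _
  have hd : Dense (⋃ i, {-d i} : Set ℂ)ᶜ := hfin.countable.dense_compl ℂ
  have hFG : F = G := hF.ext_on hd hG fun e he => by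
    have hne : ∀ i, d i + e ≠ 0 := fun i h => he <| by
      simp only [Set.mem_iUnion, Set.mem_singleton_iff]
      exact ⟨i, by linear_combination h⟩
    have hfac : (Matrix.diagonal fun i => d i + e) + Matrix.vecMulVec u w =
        (Matrix.diagonal fun i => d i + e) * (1 + Matrix.replicateCol Unit
          (fun i => u i / (d i + e)) * Matrix.replicateRow Unit w) := by
      rw [mul_add, mul_one, ← Matrix.vecMulVec_eq]
      ext i j
      simp only [Matrix.add_apply, Matrix.diagonal_mul, Matrix.vecMulVec_apply]
      field_simp [hne i]
    simp only [F, G]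
    rw [hfac, Matrix.det_mul, Matrix.det_diagonal,
      Matrix.det_one_add_replicateCol_mul_replicateRow, mul_add, mul_one, dotProduct,
      Finset.mul_sum]
    congr 1
    refine Finset.sum_congr rfl fun i _ => ?_
    rw [Fintype.prod_eq_mul_prod_compl i]
    field_simp [hne i]
  simpa [F, G] using congrFun hFG 0

/-- The product of the numbers `λ_k - t` over the eigenvalues is `det (A - t)`. -/
lemma prod_eigenvalues_sub {n : ℕ} {A : Matrix (Fin n) (Fin n) ℂ} (hA : A.IsHermitian) (t : ℝ) :
    ((∏ k, (hA.eigenvalues k - t) : ℝ) : ℂ) = (A - Matrix.scalar (Fin n) (t : ℂ)).det := by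
  have h := congrArg (Polynomial.eval (t : ℂ)) hA.charpoly_eq
  rw [Matrix.eval_charpoly, Polynomial.eval_prod] at h
  rw [← neg_sub, Matrix.det_neg, h, Fintype.card_fin]
  have := Finset.prod_const (s := (Finset.univ : Finset (Fin n))) (-1 : ℂ)
  rw [Finset.card_fin] at this
  rw [← this, ← Finset.prod_mul_distrib]
  push_cast
  refine Finset.prod_congr rfl fun i _ => ?_
  simp

/-- The real diagonal matrix with entries `x`, as a complex matrix. -/
abbrev realDiagonal {n : ℕ} (x : Fin n → ℝ) : Matrix (Fin n) (Fin n) ℂ :=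
  Matrix.diagonal fun i => (x i : ℂ)

lemma isHermitian_realDiagonal {n : ℕ} (x : Fin n → ℝ) : (realDiagonal x).IsHermitian := by
  refine Matrix.isHermitian_diagonal_of_self_adjoint _ ?_
  ext i
  simp

lemma isHermitian_rankOneModification_realDiagonal {n : ℕ} (x : Fin n → ℝ) (v : Fin n → ℂ) :
    (rankOneModification (realDiagonal x) v).IsHermitian :=
  isHermitian_rankOneModification (isHermitian_realDiagonal x) v

/-- Both sides are det(diag(x) + vv* - x_j): the j-th diagonal entry vanishes, so only the j-th term
of the determinant formula survives. -/
lemma prod_eigenvalues_rankOneModification_sub {n : ℕ} (x : Fin n → ℝ) (v : Fin n → ℂ)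
    (j : Fin n) :
    ∏ k, ((isHermitian_rankOneModification_realDiagonal x v).eigenvalues k - x j) =
      Complex.normSq (v j) * ∏ k ∈ {j}ᶜ, (x k - x j) := by
  have h := prod_eigenvalues_sub (isHermitian_rankOneModification_realDiagonal x v) (x j)
  have e : rankOneModification (realDiagonal x) v - Matrix.scalar (Fin n) (x j : ℂ) =
      Matrix.diagonal (fun i => (x i : ℂ) - x j) + Matrix.vecMulVec v (star v) := by
    rw [rankOneModification, Matrix.scalar_apply, add_sub_right_comm, Matrix.diagonal_sub]
  rw [e, det_diagonal_add_vecMulVec,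
    Finset.prod_eq_zero (f := fun i => (x i : ℂ) - x j) (Finset.mem_univ j) (sub_self _),
    zero_add, Finset.sum_eq_single j] at h
  · have h2 : v j * star v j = (Complex.normSq (v j) : ℂ) := Complex.mul_conj _
    rw [h2] at h
    exact_mod_cast h
  · intro i _ hij
    rw [Finset.prod_eq_zero (i := j), mul_zero]
    · simpa using hij.symm
    · simp
  · simp

lemma sum_eigenvalues_rankOneModification {n : ℕ} (x : Fin n → ℝ) (v : Fin n → ℂ) :
    ∑ k, (isHermitian_rankOneModification_realDiagonal x v).eigenvalues k =
      ∑ k, x k + ∑ k, Complex.normSq (v k) := by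
  have h := (isHermitian_rankOneModification_realDiagonal x v).trace_eq_sum_eigenvalues
  change (realDiagonal x + Matrix.vecMulVec v (star v)).trace = _ at h
  rw [Matrix.trace_add, Matrix.trace_diagonal] at h
  have h2 : (Matrix.vecMulVec v (star v)).trace = ∑ k, (Complex.normSq (v k) : ℂ) :=
    Finset.sum_congr rfl fun k _ => Complex.mul_conj _
  rw [h2] at h
  apply Complex.ofReal_injective
  push_cast
  exact h.symm

lemma exists_perm_eigenvalues_mem_interlacingSet {n : ℕ} {x : Fin n → ℝ} (hx : StrictMono x)
    {v : Fin n → ℂ} (hv : ∀ j, v j ≠ 0) :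
    ∃ σ : Equiv.Perm (Fin n),
      (isHermitian_rankOneModification_realDiagonal x v).eigenvalues ∘ σ ∈ interlacingSet x ∧
      interlacingWeights x ((isHermitian_rankOneModification_realDiagonal x v).eigenvalues ∘ σ) =
        fun j => Complex.normSq (v j) := by
  set y := (isHermitian_rankOneModification_realDiagonal x v).eigenvalues with hy
  have hw : interlacingWeights x (y ∘ Tuple.sort y) = fun j => Complex.normSq (v j) := by
    ext j
    rw [interlacingWeights, div_eq_iff (prod_compl_sub_ne_zero hx.injective j),
      ← prod_eigenvalues_rankOneModification_sub]
    exact Equiv.prod_comp (Tuple.sort y) fun k => y k - x j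
  exact ⟨Tuple.sort y, mem_interlacingSet_of_pos hx (Tuple.monotone_sort y) fun j => by
    rw [hw]; exact Complex.normSq_pos.2 (hv j), hw⟩

/-- The vector of square roots, as a complex vector. -/
def sqrtVec {n : ℕ} (w : Fin n → ℝ) : Fin n → ℂ := fun j => (Real.sqrt (w j) : ℂ)

lemma normSq_sqrtVec {n : ℕ} {w : Fin n → ℝ} {j : Fin n} (hw : 0 ≤ w j) :
    Complex.normSq (sqrtVec w j) = w j := by
  rw [sqrtVec, Complex.normSq_ofReal, Real.mul_self_sqrt hw]

lemma sqrtVec_ne_zero {n : ℕ} {w : Fin n → ℝ} {j : Fin n} (hw : 0 < w j) :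
    sqrtVec w j ≠ 0 := by
  rw [sqrtVec]
  exact_mod_cast (Real.sqrt_pos.2 hw).ne'

/-- Realises every interlacing y as a spectrum: the spectrum built from its weights interlaces and
has the same weights, and the weights are injective on the interlacing set. -/
lemma exists_perm_eigenvalues_sqrtVec_interlacingWeights {n : ℕ} {x y : Fin n → ℝ}
    (hx : StrictMono x) (hy : y ∈ interlacingSet x) :
    ∃ σ : Equiv.Perm (Fin n), (isHermitian_rankOneModification_realDiagonal x
      (sqrtVec (interlacingWeights x y))).eigenvalues ∘ σ = y := by
  have hpos := interlacingWeights_pos hx hy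
  obtain ⟨σ, hσ, hw⟩ := exists_perm_eigenvalues_mem_interlacingSet hx
    fun j => sqrtVec_ne_zero (hpos j)
  refine ⟨σ, interlacingWeights_injOn hx.injective hσ hy (hw.trans ?_)⟩
  ext j
  exact normSq_sqrtVec (hpos j).le

lemma image_interlacingWeights {n : ℕ} {x : Fin n → ℝ} (hx : StrictMono x) :
    interlacingWeights x '' interlacingSet x = Set.univ.pi fun _ => Set.Ioi 0 := by
  ext w
  simp only [Set.mem_image, Set.mem_univ_pi, Set.mem_Ioi]
  constructor
  · rintro ⟨y, hy, rfl⟩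
    exact interlacingWeights_pos hx hy
  · intro hw
    obtain ⟨σ, hσ, h⟩ := exists_perm_eigenvalues_mem_interlacingSet hx
      fun j => sqrtVec_ne_zero (hw j)
    exact ⟨_, hσ, h.trans (funext fun j => normSq_sqrtVec (hw j).le)⟩

/-- The trace identity for a rank one modification whose spectrum is y. -/
lemma sum_interlacingWeights {n : ℕ} {x y : Fin n → ℝ} (hx : StrictMono x)
    (hy : y ∈ interlacingSet x) : ∑ j, interlacingWeights x y j = ∑ j, y j - ∑ j, x j := by
  obtain ⟨σ, h⟩ := exists_perm_eigenvalues_sqrtVec_interlacingWeights hx hy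
  have hs := sum_eigenvalues_rankOneModification x (sqrtVec (interlacingWeights x y))
  rw [← Equiv.sum_comp σ] at hs
  have : ∀ k, (isHermitian_rankOneModification_realDiagonal x
      (sqrtVec (interlacingWeights x y))).eigenvalues (σ k) = y k := fun k => congrFun h k
  simp only [this, normSq_sqrtVec (interlacingWeights_pos hx hy _).le] at hs
  linarith

/-! ### The Jacobian and the change of variables -/

lemma abs_prod_prod_compl_sub {n : ℕ} (x : Fin n → ℝ) :
    |∏ j, ∏ k ∈ {j}ᶜ, (x k - x j)| = vandermondeProd x ^ 2 := by
  rw [← Finset.prod_prod_Ioi_mul_eq_prod_prod_off_diag fun k j => x k - x j,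
    Finset.abs_prod, vandermondeProd, ← Finset.prod_pow]
  refine Finset.prod_congr rfl fun i _ => ?_
  rw [Finset.abs_prod, ← Finset.prod_pow]
  refine Finset.prod_congr rfl fun j _ => ?_
  rw [abs_mul, abs_sub_comm (x i), ← sq, sq_abs]

open Polynomial in
-- Row j evaluates at x_j polynomials of degree less than n that depend only on y, so the matrix is
-- a Vandermonde matrix in x times a coefficient matrix D. Taking x = y makes it diagonal with |det|
-- = Δ(y)², whence |det D| = |Δ(y)|.
lemma abs_det_prod_compl_sub {n : ℕ} (x : Fin n → ℝ) {y : Fin n → ℝ}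
    (hy : Function.Injective y) :
    |(Matrix.of fun j k : Fin n => ∏ l ∈ {k}ᶜ, (y l - x j)).det| =
      |vandermondeProd x| * |vandermondeProd y| := by
  let q : Fin n → ℝ[X] := fun k => ∏ l ∈ {k}ᶜ, (C (y l) - X)
  let D : Matrix (Fin n) (Fin n) ℝ := Matrix.of fun m k => (q k).coeff m
  have hq : ∀ k, (q k).natDegree < n := fun k => by
    refine (Polynomial.natDegree_prod_le _ _).trans_lt ?_
    refine (Finset.sum_le_card_nsmul _ _ 1 fun l _ => ?_).trans_lt ?_
    · exact (Polynomial.natDegree_sub_le _ _).trans (by simp)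
    · have := k.pos
      simp only [Finset.card_compl, Fintype.card_fin, Finset.card_singleton, smul_eq_mul, mul_one]
      omega
  have hV : ∀ z : Fin n → ℝ, (Matrix.of fun j k : Fin n => ∏ l ∈ {k}ᶜ, (y l - z j)) =
      Matrix.vandermonde z * D := fun z => by
    ext j k
    have : (q k).eval (z j) = ∏ l ∈ {k}ᶜ, (y l - z j) := by
      simp [q, Polynomial.eval_prod]
    rw [Matrix.of_apply, ← this, Polynomial.eval_eq_sum_range' (hq k), Matrix.mul_apply,
      ← Fin.sum_univ_eq_sum_range fun i => (q k).coeff i * z j ^ i]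
    refine Finset.sum_congr rfl fun m _ => ?_
    rw [Matrix.vandermonde_apply, mul_comm]
    rfl
  have hdiag : (Matrix.of fun j k : Fin n => ∏ l ∈ {k}ᶜ, (y l - y j)) =
      Matrix.diagonal fun k => ∏ l ∈ {k}ᶜ, (y l - y k) := by
    ext j k
    rcases eq_or_ne j k with rfl | h
    · simp
    · rw [Matrix.of_apply, Matrix.diagonal_apply_ne _ h]
      exact Finset.prod_eq_zero (i := j) (by simpa using h) (sub_self _)
  have h1 := congrArg Matrix.det ((hV y).symm.trans hdiag)
  rw [Matrix.det_mul, Matrix.det_diagonal, ← vandermondeProd_eq_det] at h1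
  have h2 := congrArg abs h1
  rw [abs_prod_prod_compl_sub, abs_mul, ← sq_abs, sq] at h2
  have hne : |vandermondeProd y| ≠ 0 := abs_ne_zero.2 (vandermondeProd_ne_zero_iff.2 hy)
  rw [hV, Matrix.det_mul, abs_mul, ← vandermondeProd_eq_det, mul_left_cancel₀ hne h2]

/-- The Jacobian matrix of `interlacingWeights x` at `y`. -/
def interlacingJacobian {n : ℕ} (x y : Fin n → ℝ) : Matrix (Fin n) (Fin n) ℝ :=
  Matrix.of fun j k => (∏ i ∈ {j}ᶜ, (x i - x j))⁻¹ *
    (Matrix.of fun j k : Fin n => ∏ l ∈ {k}ᶜ, (y l - x j)) j k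

lemma abs_det_interlacingJacobian {n : ℕ} {x y : Fin n → ℝ} (hx : StrictMono x)
    (hy : StrictMono y) :
    |(interlacingJacobian x y).det| = vandermondeProd y / vandermondeProd x := by
  have h1 := vandermondeProd_pos hx
  have h2 := vandermondeProd_pos hy
  rw [interlacingJacobian, Matrix.det_mul_column, abs_mul, abs_det_prod_compl_sub x hy.injective,
    Finset.prod_inv_distrib, abs_inv, abs_prod_prod_compl_sub, abs_of_pos h1, abs_of_pos h2]
  field_simp

lemma hasFDerivAt_interlacingWeights {n : ℕ} (x y : Fin n → ℝ) :
    HasFDerivAt (interlacingWeights x)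
      (Matrix.toLin' (interlacingJacobian x y)).toContinuousLinearMap y := by
  rw [hasFDerivAt_pi']
  intro j
  have hg : ∀ k ∈ Finset.univ, HasFDerivAt (fun y : Fin n → ℝ => y k - x j)
      (ContinuousLinearMap.proj k : (Fin n → ℝ) →L[ℝ] ℝ) y :=
    fun k _ => (hasFDerivAt_apply k y).sub_const (x j)
  have h := HasFDerivAt.finsetProd hg
  have h' := h.mul_const (∏ k ∈ {j}ᶜ, (x k - x j))⁻¹
  simp only [interlacingWeights, div_eq_mul_inv]
  refine h'.congr_fderiv ?_
  ext u
  simp [interlacingJacobian, Matrix.mulVec, dotProduct, Finset.mul_sum, Finset.compl_singleton, mul_assoc]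

lemma isOpen_interlacingSet {n : ℕ} (x : Fin n → ℝ) : IsOpen (interlacingSet x) := by
  have : interlacingSet x = (⋂ i, {y | x i < y i}) ∩ ⋂ i, ⋂ j, {y | i < j → y i < x j} := by
    ext y
    simp [interlacingSet]
  rw [this]
  refine (isOpen_iInter_of_finite fun i => isOpen_lt continuous_const (continuous_apply i)).inter
    (isOpen_iInter_of_finite fun i => isOpen_iInter_of_finite fun j => ?_)
  by_cases h : i < j
  · simpa [h] using isOpen_lt (continuous_apply i) continuous_const
  · simp [h]

/-- Change of variables from the weights to the interlacing eigenvalues. -/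
lemma lintegral_pi_Ioi_eq_lintegral_interlacingSet {n : ℕ} {x : Fin n → ℝ} (hx : StrictMono x)
    (F : (Fin n → ℝ) → ℝ≥0∞) :
    ∫⁻ w in Set.univ.pi fun _ => Set.Ioi (0 : ℝ), F w =
      ∫⁻ y in interlacingSet x, ENNReal.ofReal (vandermondeProd y / vandermondeProd x) *
        F (interlacingWeights x y) := by
  rw [← image_interlacingWeights hx, lintegral_image_eq_lintegral_abs_det_fderiv_mul volume
    (isOpen_interlacingSet x).measurableSet
    (fun y _ => (hasFDerivAt_interlacingWeights x y).hasFDerivWithinAt)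
    (interlacingWeights_injOn hx.injective)]
  refine setLIntegral_congr_fun (isOpen_interlacingSet x).measurableSet fun y hy => ?_
  simp only [ContinuousLinearMap.det, LinearMap.coe_toContinuousLinearMap, LinearMap.det_toLin']
  rw [abs_det_interlacingJacobian hx (interlacingSet.strictMono hy)]

/-! ### Measurability of the eigenvalues -/

/-- A decreasing spectrum is determined by the values of det(M - k) at natural numbers k. This
continuous injection from a Polish space is a measurable embedding (Lusin–Souslin), so it suffices
that these determinants, polynomials in the entries, are measurable. -/
lemma measurable_eigenvalues {Ω : Type*} [MeasurableSpace Ω] {n : ℕ}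
    {M : Ω → Matrix (Fin n) (Fin n) ℂ} (hM : ∀ ω, (M ω).IsHermitian)
    (hmeas : ∀ i j, Measurable fun ω => M ω i j) :
    Measurable fun ω => (hM ω).eigenvalues := by
  -- `Matrix.IsHermitian.eigenvalues` is the antitone `eigenvalues₀` reindexed along this
  -- equivalence, so antitonicity is visible only after composing with `E`.
  let E : Fin (Fintype.card (Fin n)) ≃ Fin n := Fintype.equivOfCardEq (Fintype.card_fin _)
  let S : Set (Fin n → ℝ) := {a | Antitone (a ∘ E)}
  have hS : IsClosed S := by
    have : S = ⋂ i, ⋂ j, {a | i ≤ j → a (E j) ≤ a (E i)} := by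
      ext a
      simp [S, Antitone]
    rw [this]
    refine isClosed_iInter fun i => isClosed_iInter fun j => ?_
    by_cases h : i ≤ j
    · simpa [h] using isClosed_le (continuous_apply (E j)) (continuous_apply (E i))
    · simp [h]
  let F : S → ℕ → ℝ := fun a k => ∏ i, (a.1 i - k)
  have hF : Continuous F := by
    refine continuous_pi fun k => continuous_finsetProd _ fun i _ => ?_
    exact ((continuous_apply i).comp continuous_subtype_val).sub continuous_const
  have hinj : Function.Injective F := by
    intro a b hab
    obtain ⟨σ, hσ⟩ := exists_perm_of_prod_sub_eq (a := a.1) (b := b.1)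
      (x := fun j : Fin n => ((j : ℕ) : ℝ))
      (fun i j h => Fin.val_injective (Nat.cast_injective h)) fun j => congrFun hab (j : ℕ)
    have hb : b.1 ∘ E = (a.1 ∘ E) ∘ (E.trans (σ.trans E.symm)) := by
      rw [hσ]
      ext i
      simp
    have h := Tuple.unique_antitone (f := a.1 ∘ E) (σ := 1) (τ := E.trans (σ.trans E.symm))
      a.2 (by rw [← hb]; exact b.2)
    rw [← hb] at h
    ext i
    have := congrFun h (E.symm i)
    simpa using this
  have : PolishSpace S := hS.polishSpace
  have hemb : MeasurableEmbedding F := hF.measurableEmbedding hinj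
  let G : Ω → S := fun ω => ⟨(hM ω).eigenvalues, by
    have : (hM ω).eigenvalues ∘ E = (hM ω).eigenvalues₀ := by
      ext i
      simp [Matrix.IsHermitian.eigenvalues, E]
    change Antitone _
    rw [this]
    exact (hM ω).eigenvalues₀_antitone⟩
  have hG : Measurable G := by
    rw [← hemb.measurable_comp_iff]
    refine measurable_pi_lambda _ fun k => ?_
    have : (fun ω => (F ∘ G) ω k) = fun ω => (M ω - Matrix.scalar (Fin n) ((k : ℝ) : ℂ)).det.re := by
      ext ω
      rw [← prod_eigenvalues_sub (hM ω), Complex.ofReal_re]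
      rfl
    rw [this]
    refine Complex.measurable_re.comp ?_
    simp only [Matrix.det_apply]
    refine Finset.measurable_sum _ fun σ _ => Measurable.const_smul
      (Finset.measurable_prod _ fun i _ => ?_) _
    exact (hmeas _ _).sub measurable_const
  exact measurable_subtype_coe.comp hG

/-! ### Complex Gaussian vectors -/

lemma pi_withDensity_ofReal {E : Type*} [MeasureSpace E] [SigmaFinite (volume : Measure E)]
    {ρ : E → ℝ} (h0 : ∀ z, 0 ≤ ρ z) (hρ : Integrable ρ) (n : ℕ) :
    (Measure.pi fun _ : Fin n => (volume : Measure E).withDensity fun z => ENNReal.ofReal (ρ z)) =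
      volume.withDensity fun x : Fin n → E => ENNReal.ofReal (∏ i, ρ (x i)) := by
  have : IsFiniteMeasure ((volume : Measure E).withDensity fun z => ENNReal.ofReal (ρ z)) :=
    isFiniteMeasure_withDensity_ofReal hρ.2
  refine Measure.pi_eq fun s hs => ?_
  have hint : Integrable (fun x : Fin n → E => ∏ i, ρ (x i))
      (Measure.pi fun i => volume.restrict (s i)) :=
    Integrable.fintype_prod (f := fun _ : Fin n => ρ) fun i => hρ.restrict
  rw [withDensity_apply _ (.univ_pi hs), volume_pi, Measure.restrict_pi_pi,
    ← ofReal_integral_eq_lintegral_ofReal hint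
      (Filter.Eventually.of_forall fun x => Finset.prod_nonneg fun i _ => h0 _),
    integral_fintype_prod_eq_prod (fun _ : Fin n => ρ),
    ENNReal.ofReal_prod_of_nonneg fun i _ => integral_nonneg h0]
  refine Finset.prod_congr rfl fun i _ => ?_
  rw [withDensity_apply _ (hs i), ofReal_integral_eq_lintegral_ofReal hρ.restrict
    (Filter.Eventually.of_forall h0)]

/-- The density of the standard complex normal distribution. -/
def complexGaussianPDF (z : ℂ) : ℝ := Real.pi⁻¹ * Real.exp (-Complex.normSq z)

lemma complexGaussianPDF_nonneg (z : ℂ) : 0 ≤ complexGaussianPDF z := by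
  have := Real.pi_pos
  unfold complexGaussianPDF
  positivity

lemma measurable_complexGaussianPDF : Measurable complexGaussianPDF := by
  have : Continuous complexGaussianPDF := by
    unfold complexGaussianPDF
    fun_prop
  exact this.measurable

/-- The standard complex normal distribution. -/
def complexGaussian : Measure ℂ :=
  volume.withDensity fun z => ENNReal.ofReal (complexGaussianPDF z)

lemma map_prod_gaussianReal :
    ((gaussianReal 0 (1 / 2)).prod (gaussianReal 0 (1 / 2))).map
      Complex.measurableEquivRealProd.symm = complexGaussian := by
  have hv : (1 / 2 : ℝ≥0) ≠ 0 := by norm_num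
  rw [gaussianReal_of_var_ne_zero _ hv, prod_withDensity (measurable_gaussianPDF _ _)
    (measurable_gaussianPDF _ _)]
  refine Measure.ext_of_lintegral _ fun φ hφ => ?_
  have hm : Measurable fun p : ℝ × ℝ =>
      gaussianPDF 0 (1 / 2) p.1 * gaussianPDF 0 (1 / 2) p.2 :=
    ((measurable_gaussianPDF _ _).comp measurable_fst).mul
      ((measurable_gaussianPDF _ _).comp measurable_snd)
  have hφ' : Measurable fun p : ℝ × ℝ => φ (Complex.measurableEquivRealProd.symm p) :=
    hφ.comp (MeasurableEquiv.measurable _)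
  rw [lintegral_map hφ (MeasurableEquiv.measurable _), complexGaussian,
    lintegral_withDensity_eq_lintegral_mul _ measurable_complexGaussianPDF.ennreal_ofReal hφ,
    ← Complex.volume_preserving_equiv_real_prod.symm.lintegral_comp_emb
      (MeasurableEquiv.measurableEmbedding _), ← Measure.volume_eq_prod,
    lintegral_withDensity_eq_lintegral_mul _ hm hφ']
  refine lintegral_congr fun p => ?_
  simp only [Pi.mul_apply, gaussianPDF]
  rw [← ENNReal.ofReal_mul (gaussianPDFReal_nonneg _ _ _)]
  congr 2
  have hnorm : Complex.normSq (Complex.measurableEquivRealProd.symm p) =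
      p.1 * p.1 + p.2 * p.2 := by
    rw [Complex.normSq_apply]; rfl
  rw [complexGaussianPDF, hnorm, gaussianPDFReal, gaussianPDFReal, mul_mul_mul_comm,
    ← Real.exp_add, ← mul_inv, Real.mul_self_sqrt (by positivity)]
  congr 2
  · push_cast; ring
  · push_cast; ring

instance : IsProbabilityMeasure complexGaussian := by
  rw [← map_prod_gaussianReal]
  exact Measure.isProbabilityMeasure_map (MeasurableEquiv.measurable _).aemeasurable

lemma integrable_complexGaussianPDF : Integrable complexGaussianPDF := by
  refine ⟨measurable_complexGaussianPDF.aestronglyMeasurable, ?_⟩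
  rw [hasFiniteIntegral_iff_ofReal (Filter.Eventually.of_forall complexGaussianPDF_nonneg)]
  have h := measure_univ (μ := complexGaussian)
  rw [complexGaussian, withDensity_apply _ .univ, Measure.restrict_univ] at h
  rw [h]
  exact ENNReal.one_lt_top

/-- The law of a vector of independent standard complex normal random variables. -/
def complexGaussianVector (n : ℕ) : Measure (Fin n → ℂ) :=
  Measure.pi fun _ => complexGaussian

instance (n : ℕ) : IsProbabilityMeasure (complexGaussianVector n) := by
  unfold complexGaussianVector
  infer_instance

lemma complexGaussianVector_eq_withDensity (n : ℕ) :
    complexGaussianVector n = volume.withDensity fun v : Fin n → ℂ =>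
      ENNReal.ofReal (∏ i, complexGaussianPDF (v i)) :=
  pi_withDensity_ofReal complexGaussianPDF_nonneg integrable_complexGaussianPDF n

lemma map_eq_complexGaussianVector {Ω : Type*} [MeasurableSpace Ω] {μ : Measure Ω}
    [IsProbabilityMeasure μ] {n : ℕ} {v : Ω → Fin n → ℂ} (hv : Measurable v)
    (hre : ∀ j, HasLaw (fun ω => (v ω j).re) (gaussianReal 0 (1 / 2)) μ)
    (him : ∀ j, HasLaw (fun ω => (v ω j).im) (gaussianReal 0 (1 / 2)) μ)
    (hindep : iIndepFun
      (Sum.elim (fun (j : Fin n) (ω : Ω) => (v ω j).re) (fun (j : Fin n) (ω : Ω) => (v ω j).im))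
      μ) :
    μ.map v = complexGaussianVector n := by
  set u : Fin n ⊕ Fin n → Ω → ℝ :=
    Sum.elim (fun j ω => (v ω j).re) (fun j ω => (v ω j).im) with hu
  have hum : ∀ s, Measurable (u s) := by
    rintro (j | j)
    · exact Complex.measurable_re.comp ((measurable_pi_apply j).comp hv)
    · exact Complex.measurable_im.comp ((measurable_pi_apply j).comp hv)
  have h1 := (iIndepFun_iff_map_fun_eq_pi_map fun s => (hum s).aemeasurable).1 hindep
  have h2 : (fun s => μ.map (u s)) = fun _ => gaussianReal 0 (1 / 2) := by
    ext1 s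
    rcases s with j | j
    · exact (hre j).map_eq
    · exact (him j).map_eq
  rw [h2] at h1
  have p1 := measurePreserving_sumPiEquivProdPi
    (fun _ : Fin n ⊕ Fin n => gaussianReal 0 (1 / 2))
  have p2 := (measurePreserving_arrowProdEquivProdArrow ℝ ℝ (Fin n)
    (fun _ => gaussianReal 0 (1 / 2)) (fun _ => gaussianReal 0 (1 / 2))).symm
  have p3 := Measure.pi_map_pi (ι := Fin n)
    (μ := fun _ => (gaussianReal 0 (1 / 2)).prod (gaussianReal 0 (1 / 2)))
    (f := fun _ => Complex.measurableEquivRealProd.symm)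
    (hμ := fun _ => by rw [map_prod_gaussianReal]; infer_instance)
    fun _ => (MeasurableEquiv.measurable _).aemeasurable
  rw [map_prod_gaussianReal] at p3
  have hm3 : Measurable fun (x : Fin n → ℝ × ℝ) i => Complex.measurableEquivRealProd.symm (x i) :=
    measurable_pi_lambda _ fun i => (MeasurableEquiv.measurable _).comp (measurable_pi_apply i)
  -- Regroup the 2n independent real coordinates into n pairs, then read each pair as a complex
  -- number.
  rw [complexGaussianVector, ← p3, ← p2.map_eq, ← p1.map_eq, ← h1,
    Measure.map_map p1.measurable (measurable_pi_lambda _ hum),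
    Measure.map_map p2.measurable (p1.measurable.comp (measurable_pi_lambda _ hum)),
    Measure.map_map hm3 (p2.measurable.comp (p1.measurable.comp (measurable_pi_lambda _ hum)))]
  rfl

lemma integrable_expKernel : Integrable expKernel := by
  have h := integrable_indicator_iff (f := fun t => Real.exp (-t)) (μ := volume)
    (measurableSet_Ioi (a := (0 : ℝ)))
  refine (h.2 (integrableOn_exp_neg_Ioi 0)).congr (Filter.Eventually.of_forall fun t => ?_)
  simp [expKernel, Set.indicator_apply]

lemma expKernel_nonneg (t : ℝ) : 0 ≤ expKernel t := by
  unfold expKernel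
  split_ifs <;> positivity

lemma measurable_expKernel : Measurable expKernel :=
  Measurable.ite measurableSet_Ioi (by fun_prop) measurable_const

/-- Polar coordinates: the angle contributes 2π, and π⁻¹ · 2π · r dr = 2r dr is dt for t = r². -/
lemma map_normSq_complexGaussian :
    complexGaussian.map Complex.normSq =
      volume.withDensity fun t => ENNReal.ofReal (expKernel t) := by
  have hsq : Measurable Complex.normSq := Complex.continuous_normSq.measurable
  refine Measure.ext_of_lintegral _ fun φ hφ => ?_
  have hφ' : Measurable fun z => φ (Complex.normSq z) := hφ.comp hsq
  rw [lintegral_map hφ hsq, complexGaussian,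
    lintegral_withDensity_eq_lintegral_mul _ measurable_complexGaussianPDF.ennreal_ofReal
      hφ', ← Complex.lintegral_comp_polarCoord_symm,
    lintegral_withDensity_eq_lintegral_mul _ measurable_expKernel.ennreal_ofReal hφ]
  have hR : ∫⁻ t, ((fun t => ENNReal.ofReal (expKernel t)) * φ) t =
      ∫⁻ t in Set.Ioi 0, ENNReal.ofReal (Real.exp (-t)) * φ t := by
    rw [← lintegral_indicator measurableSet_Ioi]
    refine lintegral_congr fun t => ?_
    by_cases ht : 0 < t <;> simp [expKernel, ht]
  have himg : (fun r : ℝ => r ^ 2) '' Set.Ioi 0 = Set.Ioi 0 := by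
    ext t
    constructor
    · rintro ⟨r, hr, rfl⟩
      exact pow_pos (Set.mem_Ioi.1 hr) 2
    · exact fun ht => ⟨√t, Real.sqrt_pos.2 ht, Real.sq_sqrt ht.le⟩
  have hchange := lintegral_image_eq_lintegral_abs_deriv_mul (f := fun r : ℝ => r ^ 2)
    (f' := fun r => 2 * r) (s := Set.Ioi 0) measurableSet_Ioi
    (fun r _ => by simpa using (hasDerivAt_pow 2 r).hasDerivWithinAt)
    (fun a ha b hb h => (sq_eq_sq₀ (le_of_lt ha) (le_of_lt hb)).1 h)
    (fun t => ENNReal.ofReal (Real.exp (-t)) * φ t)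
  rw [hR, ← himg, hchange, polarCoord_target, Measure.volume_eq_prod,
    ← Measure.prod_restrict]
  have hint : ∀ p : ℝ × ℝ, ENNReal.ofReal p.1 •
      ((fun z => ENNReal.ofReal (complexGaussianPDF z)) * fun z => φ (Complex.normSq z))
        (Complex.polarCoord.symm p) =
      (ENNReal.ofReal p.1 * (ENNReal.ofReal (Real.pi⁻¹ * Real.exp (-p.1 ^ 2)) * φ (p.1 ^ 2))) * 1 := by
    intro p
    have : Complex.normSq (Complex.polarCoord.symm p) = p.1 ^ 2 := by
      rw [Complex.normSq_eq_norm_sq, Complex.norm_polarCoord_symm, sq_abs]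
    simp only [Pi.mul_apply, complexGaussianPDF, this, smul_eq_mul, mul_one]
  simp only [hint]
  have hf : Measurable fun r : ℝ => ENNReal.ofReal r *
      (ENNReal.ofReal (Real.pi⁻¹ * Real.exp (-r ^ 2)) * φ (r ^ 2)) := by fun_prop
  rw [lintegral_prod_mul (f := fun r : ℝ => ENNReal.ofReal r *
      (ENNReal.ofReal (Real.pi⁻¹ * Real.exp (-r ^ 2)) * φ (r ^ 2))) (g := fun _ => 1)
    hf.aemeasurable aemeasurable_const, lintegral_one, Measure.restrict_apply_univ,
    Real.volume_Ioo, ← lintegral_mul_const' _ _ ENNReal.ofReal_ne_top]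
  refine setLIntegral_congr_fun measurableSet_Ioi fun r hr => ?_
  have hr' : (0 : ℝ) < r := hr
  have hpi := Real.pi_pos
  rw [abs_of_pos (by positivity), ← mul_assoc, ← mul_assoc, mul_right_comm,
    ← ENNReal.ofReal_mul (by positivity), ← ENNReal.ofReal_mul (by positivity),
    ← ENNReal.ofReal_mul (by positivity)]
  congr 2
  field_simp
  ring

lemma map_normSq_complexGaussianVector (n : ℕ) :
    (complexGaussianVector n).map (fun v j => Complex.normSq (v j)) =
      volume.withDensity fun w : Fin n → ℝ => ENNReal.ofReal (∏ i, expKernel (w i)) := by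
  have hm : Measurable Complex.normSq := Complex.continuous_normSq.measurable
  have p := Measure.pi_map_pi (ι := Fin n) (μ := fun _ => complexGaussian)
    (f := fun _ => Complex.normSq)
    (hμ := fun _ => @IsFiniteMeasure.toSigmaFinite _ _ _ inferInstance)
    fun _ => hm.aemeasurable
  rw [complexGaussianVector, p, map_normSq_complexGaussian,
    pi_withDensity_ofReal expKernel_nonneg integrable_expKernel]

lemma prod_complexGaussianPDF {n : ℕ} (v : Fin n → ℂ) :
    ∏ i, complexGaussianPDF (v i) =
      Real.pi⁻¹ ^ n * Real.exp (-∑ i, Complex.normSq (v i)) := by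
  simp [complexGaussianPDF, Finset.prod_mul_distrib, Finset.sum_neg_distrib, ← Real.exp_sum]

lemma sum_normSq_mulVec {n : ℕ} {U : Matrix (Fin n) (Fin n) ℂ} (hU : star U * U = 1)
    (v : Fin n → ℂ) :
    ∑ i, Complex.normSq (U.mulVec v i) = ∑ i, Complex.normSq (v i) := by
  have h : ∀ u : Fin n → ℂ, ((∑ i, Complex.normSq (u i) : ℝ) : ℂ) = star u ⬝ᵥ u := fun u => by
    rw [dotProduct]
    push_cast
    refine Finset.sum_congr rfl fun i _ => ?_
    rw [Complex.normSq_eq_conj_mul_self]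
    rfl
  apply Complex.ofReal_injective
  rw [h, h, Matrix.star_mulVec, Matrix.dotProduct_mulVec, Matrix.vecMul_vecMul,
    ← Matrix.star_eq_conjTranspose, hU, Matrix.vecMul_one]

/-- The density depends only on Σ|v_i|², which `U` preserves, and a linear bijection scales Lebesgue
measure by a constant. Both laws are probabilities, so that constant is 1 and the determinant need
not be computed. -/
lemma map_mulVec_complexGaussianVector {n : ℕ} {U : Matrix (Fin n) (Fin n) ℂ}
    (hU : star U * U = 1) :
    (complexGaussianVector n).map U.mulVec = complexGaussianVector n := by
  have hU' : U * star U = 1 := mul_eq_one_comm.1 hU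
  let L : (Fin n → ℂ) →ₗ[ℝ] (Fin n → ℂ) := U.mulVecLin.restrictScalars ℝ
  let L' : (Fin n → ℂ) →ₗ[ℝ] (Fin n → ℂ) := (star U).mulVecLin.restrictScalars ℝ
  have hL : ∀ v, L v = U.mulVec v := fun _ => rfl
  have hdet : LinearMap.det L ≠ 0 := by
    have : L ∘ₗ L' = LinearMap.id := by
      refine LinearMap.ext fun v => ?_
      simp only [L, L', LinearMap.comp_apply, LinearMap.restrictScalars_apply,
        Matrix.mulVecLin_apply, Matrix.mulVec_mulVec, hU', Matrix.one_mulVec, LinearMap.id_apply]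
    have h := congrArg LinearMap.det this
    rw [LinearMap.det_comp, LinearMap.det_id] at h
    exact left_ne_zero_of_mul_eq_one h
  have hLm : Measurable U.mulVec := L.continuous_of_finiteDimensional.measurable
  have hvol := Measure.map_linearMap_addHaar_eq_smul_addHaar
    (volume : Measure (Fin n → ℂ)) hdet
  set c := ENNReal.ofReal |(LinearMap.det L)⁻¹|
  have hρ : Measurable fun v : Fin n → ℂ => ENNReal.ofReal (∏ i, complexGaussianPDF (v i)) :=
    (Finset.measurable_prod _ fun i _ =>
      measurable_complexGaussianPDF.comp (measurable_pi_apply i)).ennreal_ofReal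
  have hmap : (complexGaussianVector n).map U.mulVec = c • complexGaussianVector n := by
    refine Measure.ext_of_lintegral _ fun φ hφ => ?_
    have hφ' : Measurable fun v => φ (U.mulVec v) := hφ.comp hLm
    rw [lintegral_map hφ hLm, lintegral_smul_measure, complexGaussianVector_eq_withDensity,
      lintegral_withDensity_eq_lintegral_mul _ hρ hφ',
      lintegral_withDensity_eq_lintegral_mul _ hρ hφ, ← lintegral_smul_measure, ← hvol,
      lintegral_map (hρ.mul hφ) (g := L) hLm]
    refine lintegral_congr fun v => ?_
    simp only [Pi.mul_apply, hL, prod_complexGaussianPDF,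
      sum_normSq_mulVec hU]
  have h := congrArg (fun m => m Set.univ) hmap
  have hp : IsProbabilityMeasure ((complexGaussianVector n).map U.mulVec) :=
    Measure.isProbabilityMeasure_map hLm.aemeasurable
  simp only [measure_univ, Measure.smul_apply, smul_eq_mul, mul_one] at h
  rw [hmap, ← h, one_smul]

/-! ### Symmetrization and null sets -/

/-- The average of `φ` over all permutations of the coordinates. -/
def symmetrization {n : ℕ} (φ : (Fin n → ℝ) → ℝ≥0∞) (x : Fin n → ℝ) : ℝ≥0∞ :=
  (n.factorial : ℝ≥0∞)⁻¹ * ∑ σ : Equiv.Perm (Fin n), φ (x ∘ σ)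

lemma measurable_comp_perm {n : ℕ} (σ : Equiv.Perm (Fin n)) :
    Measurable fun x : Fin n → ℝ => x ∘ σ :=
  measurable_pi_lambda _ fun i => measurable_pi_apply (σ i)

lemma measurable_symmetrization {n : ℕ} {φ : (Fin n → ℝ) → ℝ≥0∞} (hφ : Measurable φ) :
    Measurable (symmetrization φ) :=
  (Finset.measurable_sum _ fun σ _ => hφ.comp (measurable_comp_perm σ)).const_mul _

lemma symmetrization_comp_perm {n : ℕ} (φ : (Fin n → ℝ) → ℝ≥0∞) (x : Fin n → ℝ)
    (τ : Equiv.Perm (Fin n)) : symmetrization φ (x ∘ τ) = symmetrization φ x := by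
  rw [symmetrization, symmetrization,
    ← Equiv.sum_comp (Equiv.mulLeft τ) fun σ : Equiv.Perm (Fin n) => φ (x ∘ σ)]
  rfl

lemma symmetrization_eq_self {n : ℕ} {φ : (Fin n → ℝ) → ℝ≥0∞}
    (hφ : ∀ x (σ : Equiv.Perm (Fin n)), φ (x ∘ σ) = φ x) (x : Fin n → ℝ) :
    symmetrization φ x = φ x := by
  simp only [symmetrization, hφ, Finset.sum_const, Finset.card_univ, Fintype.card_perm,
    Fintype.card_fin, nsmul_eq_mul]
  rw [← mul_assoc, ENNReal.inv_mul_cancel (by exact_mod_cast n.factorial_ne_zero)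
    (ENNReal.natCast_ne_top _), one_mul]

lemma lintegral_symmetrizedLaw {n : ℕ} (ν : Measure (Fin n → ℝ)) {φ : (Fin n → ℝ) → ℝ≥0∞}
    (hφ : Measurable φ) : ∫⁻ x, φ x ∂(symmetrizedLaw ν) = ∫⁻ x, symmetrization φ x ∂ν := by
  simp only [symmetrizedLaw, symmetrization]
  rw [lintegral_smul_measure, lintegral_finsetSum_measure, lintegral_const_mul',
    lintegral_finsetSum, smul_eq_mul]
  · congr 1
    exact Finset.sum_congr rfl fun σ _ => lintegral_map hφ (measurable_comp_perm σ)
  · exact fun σ _ => hφ.comp (measurable_comp_perm σ)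
  · exact ENNReal.inv_ne_top.2 (by exact_mod_cast n.factorial_ne_zero)

lemma ae_injective (n : ℕ) : ∀ᵐ x : Fin n → ℝ, Function.Injective x := by
  have h : ∀ i j : Fin n, i ≠ j → ∀ᵐ x : Fin n → ℝ, x i ≠ x j := fun i j hij => by
    let s : Submodule ℝ (Fin n → ℝ) :=
      LinearMap.ker ((LinearMap.proj i : (Fin n → ℝ) →ₗ[ℝ] ℝ) - LinearMap.proj j)
    have hs : s ≠ ⊤ := fun hs => by
      have : (Pi.single i 1 : Fin n → ℝ) ∈ s := hs ▸ Submodule.mem_top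
      simp [s, LinearMap.mem_ker, hij.symm] at this
    have h0 := Measure.addHaar_submodule (volume : Measure (Fin n → ℝ)) s hs
    refine measure_mono_null (fun x hx => ?_) h0
    simp only [Set.mem_compl_iff, Set.mem_ofPred_eq, not_not] at hx
    simp [s, LinearMap.mem_ker, hx]
  have h' : ∀ᵐ x : Fin n → ℝ, ∀ i j : Fin n, i ≠ j → x i ≠ x j := by
    refine ae_all_iff.2 fun i => ae_all_iff.2 fun j => ?_
    by_cases hij : i = j
    · simp [hij]
    · filter_upwards [h i j hij] with x hx _ using hx
  filter_upwards [h'] with x hx i j hij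
  by_contra hne
  exact hx i j hne hij

lemma ae_apply_ne {n : ℕ} (x : Fin n → ℝ) : ∀ᵐ y : Fin n → ℝ, ∀ i j, y i ≠ x j := by
  refine ae_all_iff.2 fun i => ae_all_iff.2 fun j => ?_
  have h : ∀ᵐ t : ℝ, t ≠ x j := by simp [ae_iff]
  exact (Measure.quasiMeasurePreserving_eval (fun _ : Fin n => (volume : Measure ℝ)) i).ae h

lemma ae_complexGaussianVector_ne_zero (n : ℕ) :
    ∀ᵐ v ∂(complexGaussianVector n), ∀ j, v j ≠ 0 := by
  refine ae_all_iff.2 fun i => ?_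
  have h0 : ∀ᵐ t : ℂ, t ≠ 0 := by simp [ae_iff]
  have h : ∀ᵐ t : ℂ ∂complexGaussian, t ≠ 0 :=
    (withDensity_absolutelyContinuous _ _ : complexGaussian ≪ volume).ae_le h0
  exact (Measure.quasiMeasurePreserving_eval (fun _ : Fin n => complexGaussian) i).ae h

lemma measurable_vandermondeProd {n : ℕ} : Measurable (vandermondeProd (n := n)) :=
  Finset.measurable_prod _ fun i _ => Finset.measurable_prod _ fun j _ =>
    (measurable_pi_apply j).sub (measurable_pi_apply i)

lemma measurable_transitionDensity {n : ℕ} :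
    Measurable fun p : (Fin n → ℝ) × (Fin n → ℝ) => transitionDensity p.1 p.2 := by
  simp only [transitionDensity]
  refine ((measurable_vandermondeProd.comp measurable_snd).div
    (measurable_vandermondeProd.comp measurable_fst)).mul ?_
  simp only [Matrix.det_apply]
  refine Finset.measurable_sum _ fun σ _ => Measurable.const_smul
    (Finset.measurable_prod _ fun i _ => ?_) _
  exact measurable_expKernel.comp
    (((measurable_pi_apply i).comp measurable_snd).sub ((measurable_pi_apply _).comp measurable_fst))

lemma measurable_eigenvalues_rankOneModification_realDiagonal {n : ℕ} (x : Fin n → ℝ) :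
    Measurable fun v => (isHermitian_rankOneModification_realDiagonal x v).eigenvalues := by
  refine measurable_eigenvalues _ fun i j => ?_
  exact measurable_const.add ((measurable_pi_apply i).mul
    (Complex.continuous_conj.measurable.comp (measurable_pi_apply j)))

lemma lintegral_comp_perm {n : ℕ} (σ : Equiv.Perm (Fin n)) (F : (Fin n → ℝ) → ℝ≥0∞) :
    ∫⁻ y, F (y ∘ σ) = ∫⁻ y, F y :=
  (volume_measurePreserving_piCongrLeft (fun _ : Fin n => ℝ) σ.symm).lintegral_comp_emb
    (MeasurableEquiv.measurableEmbedding _) F ▸ lintegral_congr fun y => by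
      congr 1
      ext i
      simp [MeasurableEquiv.piCongrLeft, Equiv.piCongrLeft_apply]

lemma prod_expKernel_eq_indicator {n : ℕ} (w : Fin n → ℝ) :
    ∏ i, expKernel (w i) =
      (Set.univ.pi fun _ => Set.Ioi (0 : ℝ)).indicator (fun w => Real.exp (-∑ i, w i)) w := by
  by_cases h : w ∈ Set.univ.pi fun _ => Set.Ioi (0 : ℝ)
  · rw [Set.indicator_of_mem h, ← Finset.sum_neg_distrib, Real.exp_sum]
    exact Finset.prod_congr rfl fun i _ => if_pos (h i (Set.mem_univ i))
  · rw [Set.indicator_of_notMem h]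
    simp only [Set.mem_univ_pi, not_forall] at h
    obtain ⟨i, hi⟩ := h
    exact Finset.prod_eq_zero (Finset.mem_univ i) (if_neg hi)

/-! ### The conditional law given the unperturbed matrix -/

/-- Up to order the spectrum depends on v only through the exponential variables |v_j|². Changing
variables to the interlacing set and summing over orderings produces the determinant; the factor
1/n! comes from the symmetrization. -/
lemma lintegral_eigenvalues_rankOneModification_realDiagonal {n : ℕ} {x : Fin n → ℝ}
    (hx : StrictMono x) {φ : (Fin n → ℝ) → ℝ≥0∞} (hφ : Measurable φ) :
    ∫⁻ v, symmetrization φ (isHermitian_rankOneModification_realDiagonal x v).eigenvalues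
        ∂(complexGaussianVector n) =
      (n.factorial : ℝ≥0∞)⁻¹ * ∫⁻ y, φ y * ENNReal.ofReal (transitionDensity x y) := by
  let Ψ : (Fin n → ℝ) → ℝ≥0∞ := fun w =>
    symmetrization φ (isHermitian_rankOneModification_realDiagonal x (sqrtVec w)).eigenvalues
  have hsqrt : Measurable fun w : Fin n → ℝ => sqrtVec w :=
    measurable_pi_lambda _ fun i => Complex.measurable_ofReal.comp
      (Real.continuous_sqrt.measurable.comp (measurable_pi_apply i))
  have hΨ : Measurable Ψ := (measurable_symmetrization hφ).comp
    ((measurable_eigenvalues_rankOneModification_realDiagonal x).comp hsqrt)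
  have hnormSq : Measurable fun (v : Fin n → ℂ) j => Complex.normSq (v j) :=
    measurable_pi_lambda _ fun i =>
      Complex.continuous_normSq.measurable.comp (measurable_pi_apply i)
  -- The spectra for v and for (|v_j|)_j both interlace with x and have the same weights, hence
  -- agree up to order.
  have h1 : ∀ v : Fin n → ℂ, (∀ j, v j ≠ 0) →
      symmetrization φ (isHermitian_rankOneModification_realDiagonal x v).eigenvalues =
        Ψ fun j => Complex.normSq (v j) := fun v hv => by
    have hpos : ∀ j, 0 < Complex.normSq (v j) := fun j => Complex.normSq_pos.2 (hv j)
    obtain ⟨σ, hσ, hw⟩ := exists_perm_eigenvalues_mem_interlacingSet hx hv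
    obtain ⟨τ, hτ, hw'⟩ := exists_perm_eigenvalues_mem_interlacingSet hx
      (v := sqrtVec fun j => Complex.normSq (v j)) fun j => sqrtVec_ne_zero (hpos j)
    have := interlacingWeights_injOn hx.injective hσ hτ
      (hw.trans (Eq.trans (funext fun j =>
        (normSq_sqrtVec (w := fun j => Complex.normSq (v j)) (hpos j).le).symm) hw'.symm))
    rw [← symmetrization_comp_perm _ _ σ, this, symmetrization_comp_perm]
  have h2 : ∀ y ∈ interlacingSet x, Ψ (interlacingWeights x y) = symmetrization φ y :=
    fun y hy => by
      obtain ⟨σ, hσ⟩ := exists_perm_eigenvalues_sqrtVec_interlacingWeights hx hy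
      rw [← hσ, symmetrization_comp_perm, hσ]
  let D : (Fin n → ℝ) → ℝ := fun z => vandermondeProd z / vandermondeProd x *
    Real.exp (-(∑ i, z i - ∑ i, x i))
  have hD : Measurable D := (measurable_vandermondeProd.div_const _).mul
    (Real.measurable_exp.comp (by fun_prop))
  have hD0 : ∀ z, 0 ≤ (interlacingSet x).indicator D z := fun z =>
    Set.indicator_nonneg (fun z hz => by
      have := vandermondeProd_pos hx
      have := vandermondeProd_pos (interlacingSet.strictMono hz)
      positivity) z
  have hS := (isOpen_interlacingSet x).measurableSet
  have hρ : Measurable fun w : Fin n → ℝ => ENNReal.ofReal (∏ i, expKernel (w i)) :=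
    (Finset.measurable_prod _ fun i _ =>
      measurable_expKernel.comp (measurable_pi_apply i)).ennreal_ofReal
  calc ∫⁻ v, symmetrization φ (isHermitian_rankOneModification_realDiagonal x v).eigenvalues
        ∂(complexGaussianVector n)
      = ∫⁻ v, Ψ (fun j => Complex.normSq (v j)) ∂(complexGaussianVector n) :=
        lintegral_congr_ae ((ae_complexGaussianVector_ne_zero n).mono h1)
    _ = ∫⁻ w : Fin n → ℝ, ENNReal.ofReal (∏ i, expKernel (w i)) * Ψ w := by
        rw [← lintegral_map hΨ hnormSq, map_normSq_complexGaussianVector,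
          lintegral_withDensity_eq_lintegral_mul _ hρ hΨ]
        rfl
    _ = ∫⁻ w in Set.univ.pi fun _ => Set.Ioi (0 : ℝ),
          ENNReal.ofReal (Real.exp (-∑ i, w i)) * Ψ w := by
        rw [← lintegral_indicator (.univ_pi fun _ => measurableSet_Ioi)]
        refine lintegral_congr fun w => ?_
        rw [prod_expKernel_eq_indicator]
        by_cases h : w ∈ Set.univ.pi fun _ => Set.Ioi (0 : ℝ)
        · rw [Set.indicator_of_mem h, Set.indicator_of_mem h]
        · rw [Set.indicator_of_notMem h, Set.indicator_of_notMem h]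
          simp
    _ = ∫⁻ y in interlacingSet x, ENNReal.ofReal (D y) * symmetrization φ y := by
        rw [lintegral_pi_Ioi_eq_lintegral_interlacingSet hx]
        refine setLIntegral_congr_fun hS fun y hy => ?_
        have hx0 := vandermondeProd_pos hx
        have hy0 := vandermondeProd_pos (interlacingSet.strictMono hy)
        simp only [h2 y hy, sum_interlacingWeights hx hy]
        rw [← mul_assoc, ← ENNReal.ofReal_mul (by positivity)]
    _ = ∫⁻ y, (n.factorial : ℝ≥0∞)⁻¹ * ∑ σ : Equiv.Perm (Fin n),
          ENNReal.ofReal ((interlacingSet x).indicator D y) * φ (y ∘ σ) := by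
        rw [← lintegral_indicator hS]
        refine lintegral_congr fun y => ?_
        by_cases h : y ∈ interlacingSet x
        · rw [Set.indicator_of_mem h, Set.indicator_of_mem h, ← Finset.mul_sum, symmetrization,
            mul_left_comm]
        · rw [Set.indicator_of_notMem h, Set.indicator_of_notMem h]
          simp
    _ = (n.factorial : ℝ≥0∞)⁻¹ * ∑ σ : Equiv.Perm (Fin n),
          ∫⁻ y, ENNReal.ofReal ((interlacingSet x).indicator D y) * φ (y ∘ σ) := by
        have hm : ∀ σ ∈ (Finset.univ : Finset (Equiv.Perm (Fin n))), Measurable fun y =>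
            ENNReal.ofReal ((interlacingSet x).indicator D y) * φ (y ∘ σ) := fun σ _ =>
          (hD.indicator hS).ennreal_ofReal.mul (hφ.comp (measurable_comp_perm σ))
        rw [lintegral_const_mul _ (Finset.measurable_sum _ hm), lintegral_finsetSum _ hm]
    _ = (n.factorial : ℝ≥0∞)⁻¹ * ∑ σ : Equiv.Perm (Fin n),
          ∫⁻ y, ENNReal.ofReal ((interlacingSet x).indicator D (y ∘ σ)) * φ y := by
        -- Replacing σ by its inverse and y by y ∘ σ moves the permutation from φ to the density.
        rw [← Equiv.sum_comp (Equiv.inv (Equiv.Perm (Fin n)))]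
        congr 1
        refine Finset.sum_congr rfl fun σ _ => ?_
        rw [← lintegral_comp_perm σ]
        refine lintegral_congr fun y => ?_
        congr 2
        ext i
        simp
    _ = (n.factorial : ℝ≥0∞)⁻¹ * ∫⁻ y, φ y * ENNReal.ofReal (transitionDensity x y) := by
        have hm : ∀ σ ∈ (Finset.univ : Finset (Equiv.Perm (Fin n))), Measurable fun y =>
            ENNReal.ofReal ((interlacingSet x).indicator D (y ∘ σ)) * φ y := fun σ _ =>
          ((hD.indicator hS).comp (measurable_comp_perm σ)).ennreal_ofReal.mul hφ
        rw [← lintegral_finsetSum _ hm]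
        congr 1
        refine lintegral_congr_ae ?_
        filter_upwards [ae_injective n, ae_apply_ne x] with y hy hyx
        rw [← Finset.sum_mul, mul_comm, transitionDensity_eq_sum hx hy hyx,
          ENNReal.ofReal_sum_of_nonneg fun σ _ => hD0 _]

/-- Permuting the columns of the eigenvector matrix lets the eigenvalues appear in any order;
increasing order is the one needed for interlacing. -/
lemma Matrix.IsHermitian.exists_isometry_realDiagonal {n : ℕ} {A : Matrix (Fin n) (Fin n) ℂ}
    (hA : A.IsHermitian) (τ : Equiv.Perm (Fin n)) :
    ∃ W : Matrix (Fin n) (Fin n) ℂ, star W * W = 1 ∧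
      A = W * realDiagonal (hA.eigenvalues ∘ τ) * star W := by
  let U : Matrix (Fin n) (Fin n) ℂ := hA.eigenvectorUnitary
  have hU : star U * U = 1 := Unitary.coe_star_mul_self hA.eigenvectorUnitary
  have hs : A = U * realDiagonal hA.eigenvalues * star U := hA.spectral_theorem
  refine ⟨U.submatrix id τ, ?_, ?_⟩
  · have : star (U.submatrix id τ) = (star U).submatrix τ id := rfl
    rw [this, ← Matrix.submatrix_mul _ _ _ _ _ Function.bijective_id, hU,
      Matrix.submatrix_one_equiv]
  · have h1 : star (U.submatrix id τ) = (star U).submatrix τ id := rfl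
    have h2 : realDiagonal (hA.eigenvalues ∘ τ) = (realDiagonal hA.eigenvalues).submatrix τ τ := by
      rw [realDiagonal, Matrix.submatrix_diagonal_equiv]
      rfl
    rw [h1, h2, Matrix.submatrix_mul_equiv, Matrix.submatrix_mul_equiv, ← hs]
    rfl

lemma eigenvalues_rankOneModification_conj {n : ℕ} {A W : Matrix (Fin n) (Fin n) ℂ}
    (hA : A.IsHermitian) {x : Fin n → ℝ} (hW : star W * W = 1)
    (h : A = W * realDiagonal x * star W) (v : Fin n → ℂ) :
    (isHermitian_rankOneModification hA v).eigenvalues =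
      (isHermitian_rankOneModification_realDiagonal x ((star W).mulVec v)).eigenvalues := by
  have hW' : W * star W = 1 := mul_eq_one_comm.1 hW
  rw [Matrix.IsHermitian.eigenvalues_eq_eigenvalues_iff]
  have h2 : rankOneModification A v =
      W * rankOneModification (realDiagonal x) ((star W).mulVec v) * star W := by
    rw [rankOneModification, rankOneModification, mul_add, add_mul, ← h, Matrix.mul_vecMulVec,
      Matrix.vecMulVec_mul, Matrix.mulVec_mulVec, hW', Matrix.one_mulVec, Matrix.star_mulVec,
      ← Matrix.star_eq_conjTranspose, star_star, Matrix.vecMul_vecMul, hW', Matrix.vecMul_one]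
  rw [h2, Matrix.charpoly_mul_comm, ← mul_assoc, hW, one_mul]

/-- Diagonalise A by W; the perturbing vector becomes W*v, which has the law of v. -/
lemma lintegral_eigenvalues_rankOneModification {n : ℕ} {A : Matrix (Fin n) (Fin n) ℂ}
    (hA : A.IsHermitian) (hinj : Function.Injective hA.eigenvalues)
    {φ : (Fin n → ℝ) → ℝ≥0∞} (hφ : Measurable φ) :
    ∫⁻ v, symmetrization φ (isHermitian_rankOneModification hA v).eigenvalues
        ∂(complexGaussianVector n) =
      (n.factorial : ℝ≥0∞)⁻¹ *
        ∫⁻ y, φ y * ENNReal.ofReal (transitionDensity hA.eigenvalues y) := by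
  obtain ⟨τ, hτ⟩ := exists_strictMono_comp_perm hinj
  obtain ⟨W, hW, hAW⟩ := hA.exists_isometry_realDiagonal τ
  have hm : Measurable (star W).mulVec := by
    have : Continuous (star W).mulVec := by fun_prop
    exact this.measurable
  have hF : Measurable fun v => symmetrization φ
      (isHermitian_rankOneModification_realDiagonal (hA.eigenvalues ∘ τ) v).eigenvalues :=
    (measurable_symmetrization hφ).comp (measurable_eigenvalues_rankOneModification_realDiagonal (hA.eigenvalues ∘ τ))
  have h := lintegral_eigenvalues_rankOneModification_realDiagonal hτ hφ
  rw [← map_mulVec_complexGaussianVector (U := star W)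
    (by rw [star_star]; exact mul_eq_one_comm.1 hW), lintegral_map hF hm] at h
  simp only [transitionDensity_comp_left] at h
  rw [← h]
  refine lintegral_congr fun v => ?_
  rw [eigenvalues_rankOneModification_conj hA hW hAW]

/-! ### Convolution with the exponential density -/

lemma expKernel_le_one (t : ℝ) : expKernel t ≤ 1 := by
  unfold expKernel
  split_ifs with h
  · exact Real.exp_le_one_iff.2 (by linarith)
  · exact zero_le_one

lemma integrable_expKernel_sub_mul {f : ℝ → ℝ} (hf : Integrable f) (y : ℝ) :
    Integrable fun x => expKernel (y - x) * f x :=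
  hf.bdd_mul (c := 1)
    (measurable_expKernel.comp (measurable_const.sub measurable_id)).aestronglyMeasurable
    (Filter.Eventually.of_forall fun x => by
      rw [Real.norm_of_nonneg (expKernel_nonneg _)]
      exact expKernel_le_one _)

lemma integrableOn_exp_neg_mul {f : ℝ → ℝ} (hf : Integrable f) (y : ℝ) :
    IntegrableOn (fun x => Real.exp (-x) * f (y - x)) (Set.Ioi 0) := by
  have h := ((integrable_expKernel_sub_mul hf y).comp_sub_left y).integrableOn (s := Set.Ioi 0)
  refine h.congr_fun (fun x hx => ?_) measurableSet_Ioi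
  simp [expKernel, Set.mem_Ioi.1 hx]

/-- Convolution with the exponential density. -/
def expConvolution (f : ℝ → ℝ) (y : ℝ) : ℝ := ∫ x, expKernel (y - x) * f x

lemma integral_exp_neg_mul (f : ℝ → ℝ) (y : ℝ) :
    ∫ x in Set.Ioi 0, Real.exp (-x) * f (y - x) = expConvolution f y := by
  rw [expConvolution, ← integral_sub_left_eq_self _ volume y,
    ← integral_indicator measurableSet_Ioi]
  refine integral_congr_ae (Filter.Eventually.of_forall fun x => ?_)
  by_cases hx : 0 < x <;> simp [expKernel, hx]

lemma integrable_pow_mul_expKernel (m : ℕ) : Integrable fun t => t ^ m * expKernel t := by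
  have h := Real.GammaIntegral_convergent (s := m + 1) (by positivity)
  have h' := (integrable_indicator_iff measurableSet_Ioi).2 h
  refine h'.congr (Filter.Eventually.of_forall fun t => ?_)
  by_cases ht : 0 < t <;> simp [expKernel, ht, mul_comm]

/-- Write y = x + t and expand (x + t)^m: each term is a product of an integrable function of x and
one of t, and the shear (x, y) ↦ (x, y - x) preserves Lebesgue measure. This uses every moment of f
up to order m. -/
lemma integrable_pow_mul_expConvolution {f : ℝ → ℝ} {m : ℕ}
    (hf : ∀ i ≤ m, Integrable fun x => x ^ i * f x) :
    Integrable fun y => y ^ m * expConvolution f y := by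
  have h1 : Integrable (fun p : ℝ × ℝ => (p.1 + p.2) ^ m * (f p.1 * expKernel p.2))
      ((volume : Measure ℝ).prod volume) := by
    have h : Integrable (fun p : ℝ × ℝ => ∑ i ∈ Finset.range (m + 1),
        (p.1 ^ i * f p.1) * ((m.choose i : ℝ) * (p.2 ^ (m - i) * expKernel p.2)))
        ((volume : Measure ℝ).prod volume) :=
      integrable_finsetSum _ fun i hi => (hf i (Nat.lt_succ_iff.1 (Finset.mem_range.1 hi))).mul_prod
        ((integrable_pow_mul_expKernel (m - i)).const_mul _)
    refine h.congr (Filter.Eventually.of_forall fun p => ?_)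
    simp only [add_pow, Finset.sum_mul]
    exact Finset.sum_congr rfl fun i _ => by ring
  have h2 := ((measurePreserving_prod_sub (volume : Measure ℝ) volume).integrable_comp
    h1.aestronglyMeasurable).2 h1
  have h3 := h2.integral_prod_right
  refine h3.congr (Filter.Eventually.of_forall fun y => ?_)
  simp only [expConvolution, ← integral_const_mul, Function.comp_apply]
  refine integral_congr_ae (Filter.Eventually.of_forall fun x => ?_)
  simp only
  rw [add_sub_cancel, mul_comm (f x)]

/-! ### Andréief's identity and integration over the old eigenvalues -/

lemma det_mul_det_eq_sum {n : ℕ} (H f : Fin n → ℝ → ℝ) (x : Fin n → ℝ) :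
    (Matrix.of fun i j => H j (x i)).det * (Matrix.of fun i k => f k (x i)).det =
      ∑ τ : Equiv.Perm (Fin n), ∑ σ : Equiv.Perm (Fin n),
        ((Equiv.Perm.sign τ : ℤ) : ℝ) * ((Equiv.Perm.sign σ : ℤ) : ℝ) *
          ∏ i, (H (τ i) (x i) * f (σ i) (x i)) := by
  simp only [← Matrix.det_transpose (Matrix.of fun i j => H j (x i)),
    ← Matrix.det_transpose (Matrix.of fun i k => f k (x i)), Matrix.det_apply',
    Finset.sum_mul_sum, Finset.prod_mul_distrib]
  refine Finset.sum_congr rfl fun τ _ => Finset.sum_congr rfl fun σ _ => ?_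
  simp only [Matrix.transpose_apply, Matrix.of_apply]
  ring

lemma integrable_prod_mul {n : ℕ} {H f : Fin n → ℝ → ℝ}
    (hint : ∀ j k, Integrable fun x => H j x * f k x) (τ σ : Equiv.Perm (Fin n)) :
    Integrable fun x : Fin n → ℝ => ∏ i, (H (τ i) (x i) * f (σ i) (x i)) :=
  Integrable.fintype_prod (μ := fun _ : Fin n => (volume : Measure ℝ))
    (f := fun i x => H (τ i) x * f (σ i) x) fun _ => hint _ _

lemma integrable_det_mul_det {n : ℕ} {H f : Fin n → ℝ → ℝ}
    (hint : ∀ j k, Integrable fun x => H j x * f k x) :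
    Integrable fun x : Fin n → ℝ =>
      (Matrix.of fun i j => H j (x i)).det * (Matrix.of fun i k => f k (x i)).det := by
  simp only [det_mul_det_eq_sum]
  exact integrable_finsetSum _ fun τ _ => integrable_finsetSum _ fun σ _ =>
    (integrable_prod_mul hint τ σ).const_mul _

/-- **Andréief's identity**. -/
lemma integral_det_mul_det {n : ℕ} {H f : Fin n → ℝ → ℝ}
    (hint : ∀ j k, Integrable fun x => H j x * f k x) :
    ∫ x : Fin n → ℝ,
        (Matrix.of fun i j => H j (x i)).det * (Matrix.of fun i k => f k (x i)).det =
      n.factorial * (Matrix.of fun j k => ∫ x, H j x * f k x).det := by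
  have hprod := integrable_prod_mul hint
  -- For fixed τ the sum is sign(τ) times the determinant with rows permuted by τ, so all n! choices
  -- of τ contribute equally.
  have hτ : ∀ τ : Equiv.Perm (Fin n), ∑ σ : Equiv.Perm (Fin n),
      ((Equiv.Perm.sign τ : ℤ) : ℝ) * ((Equiv.Perm.sign σ : ℤ) : ℝ) *
        ∏ i, (∫ x, H (τ i) x * f (σ i) x) =
      (Matrix.of fun j k => ∫ x, H j x * f k x).det := fun τ => by
    have hp := Matrix.det_permute τ (Matrix.of fun j k => ∫ x, H j x * f k x)
    have hs : ((Equiv.Perm.sign τ : ℤ) : ℝ) * ((Equiv.Perm.sign τ : ℤ) : ℝ) = 1 := by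
      rcases Int.units_eq_one_or (Equiv.Perm.sign τ) with h | h <;> simp [h]
    rw [← one_mul (Matrix.det _), ← hs, mul_assoc, ← hp, ← Matrix.det_transpose,
      Matrix.det_apply', Finset.mul_sum]
    refine Finset.sum_congr rfl fun σ _ => ?_
    rw [mul_assoc]
    rfl
  simp only [det_mul_det_eq_sum]
  rw [integral_finsetSum _ fun τ _ => integrable_finsetSum _ fun σ _ => (hprod τ σ).const_mul _]
  have hτ' : ∀ τ : Equiv.Perm (Fin n), ∫ x : Fin n → ℝ, ∑ σ : Equiv.Perm (Fin n),
      ((Equiv.Perm.sign τ : ℤ) : ℝ) * ((Equiv.Perm.sign σ : ℤ) : ℝ) *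
        ∏ i, (H (τ i) (x i) * f (σ i) (x i)) =
      (Matrix.of fun j k => ∫ x, H j x * f k x).det := fun τ => by
    rw [integral_finsetSum _ fun σ _ => (hprod τ σ).const_mul _, ← hτ τ]
    refine Finset.sum_congr rfl fun σ _ => ?_
    rw [integral_const_mul,
      integral_fintype_prod_volume_eq_prod fun i x => H (τ i) x * f (σ i) x]
  simp only [hτ', Finset.sum_const, Finset.card_univ, Fintype.card_perm, Fintype.card_fin,
    nsmul_eq_mul]

lemma IsPolynomialEnsemble.integrable {n : ℕ} {f : Fin n → ℝ → ℝ} {Z : ℝ}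
    (hf : IsPolynomialEnsemble f Z) (k : Fin n) : Integrable (f k) := by
  have := hf.integrable_moment ⟨0, k.pos⟩ k
  simpa using this

/-- For almost every `x`, the product of the transition density and the density of the ensemble
is, up to a factor depending only on `y`, a product of two determinants. -/
lemma transitionDensity_mul_polyEnsembleDensity {n : ℕ} (f : Fin n → ℝ → ℝ) (Z : ℝ)
    {x : Fin n → ℝ} (hx : Function.Injective x) (y : Fin n → ℝ) :
    transitionDensity x y * polyEnsembleDensity f Z x =
      1 / Z * vandermondeProd y * ((Matrix.of fun i j : Fin n => expKernel (y j - x i)).det *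
        (Matrix.of fun i k : Fin n => f k (x i)).det) := by
  have := vandermondeProd_ne_zero_iff.2 hx
  rw [transitionDensity, polyEnsembleDensity]
  field_simp

lemma integral_expKernel_det_mul_det {n : ℕ} {f : Fin n → ℝ → ℝ} (hf : ∀ k, Integrable (f k))
    (Z : ℝ) (y : Fin n → ℝ) :
    ∫ x : Fin n → ℝ, 1 / Z * vandermondeProd y *
        ((Matrix.of fun i j : Fin n => expKernel (y j - x i)).det *
          (Matrix.of fun i k : Fin n => f k (x i)).det) =
      n.factorial * polyEnsembleDensity (fun k => expConvolution (f k)) Z y := by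
  rw [integral_const_mul, integral_det_mul_det (H := fun j x => expKernel (y j - x))
    fun j k => integrable_expKernel_sub_mul (hf k) (y j), polyEnsembleDensity]
  simp only [expConvolution]
  ring

lemma IsPolynomialEnsemble.ae_expKernel_nonneg {n : ℕ} {f : Fin n → ℝ → ℝ} {Z : ℝ}
    (hf : IsPolynomialEnsemble f Z) (y : Fin n → ℝ) :
    0 ≤ᵐ[volume] fun x : Fin n → ℝ => 1 / Z * vandermondeProd y *
        ((Matrix.of fun i j : Fin n => expKernel (y j - x i)).det *
          (Matrix.of fun i k : Fin n => f k (x i)).det) := by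
  filter_upwards [ae_injective n] with x hx
  rw [← transitionDensity_mul_polyEnsembleDensity f Z hx]
  exact mul_nonneg (transitionDensity_nonneg hx y) (hf.nonneg x)

/-- For every single y the integrand is non-negative for almost every x, so the inequality holds for
all y and not merely almost everywhere. -/
lemma IsPolynomialEnsemble.expConvolution_nonneg {n : ℕ} {f : Fin n → ℝ → ℝ} {Z : ℝ}
    (hf : IsPolynomialEnsemble f Z) (y : Fin n → ℝ) :
    0 ≤ polyEnsembleDensity (fun k => expConvolution (f k)) Z y := by
  have h := integral_nonneg_of_ae (hf.ae_expKernel_nonneg y)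
  rw [integral_expKernel_det_mul_det hf.integrable] at h
  exact nonneg_of_mul_nonneg_right h (by exact_mod_cast n.factorial_pos)

lemma IsPolynomialEnsemble.lintegral_transitionDensity_mul {n : ℕ} {f : Fin n → ℝ → ℝ} {Z : ℝ}
    (hf : IsPolynomialEnsemble f Z) (y : Fin n → ℝ) :
    ∫⁻ x, ENNReal.ofReal (polyEnsembleDensity f Z x) * ENNReal.ofReal (transitionDensity x y) =
      n.factorial *
        ENNReal.ofReal (polyEnsembleDensity (fun k => expConvolution (f k)) Z y) := by
  have hint := (integrable_det_mul_det (H := fun j x => expKernel (y j - x))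
    fun j k => integrable_expKernel_sub_mul (hf.integrable k) (y j)).const_mul
    (1 / Z * vandermondeProd y)
  have h := ofReal_integral_eq_lintegral_ofReal hint (hf.ae_expKernel_nonneg y)
  rw [integral_expKernel_det_mul_det hf.integrable, ENNReal.ofReal_mul (Nat.cast_nonneg _),
    ENNReal.ofReal_natCast] at h
  rw [h]
  refine lintegral_congr_ae ?_
  filter_upwards [ae_injective n] with x hx
  rw [← ENNReal.ofReal_mul (hf.nonneg x), mul_comm,
    transitionDensity_mul_polyEnsembleDensity f Z hx]

lemma aemeasurable_polyEnsembleDensity {n : ℕ} {f : Fin n → ℝ → ℝ}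
    (hf : ∀ k, Integrable (f k)) (Z : ℝ) : AEMeasurable (polyEnsembleDensity f Z) := by
  unfold polyEnsembleDensity
  refine AEMeasurable.mul (measurable_vandermondeProd.const_mul _).aemeasurable ?_
  simp only [Matrix.det_apply]
  refine Finset.aemeasurable_fun_sum _ fun σ _ => AEMeasurable.const_smul
    (Finset.aemeasurable_fun_prod _ fun i _ => ?_) _
  exact (hf i).aestronglyMeasurable.aemeasurable.comp_quasiMeasurePreserving
    (Measure.quasiMeasurePreserving_eval (fun _ : Fin n => (volume : Measure ℝ)) (σ i))

/-! ### The law of the perturbed eigenvalues -/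

/-- The Hermitian part of a matrix. -/
def hermitianPart {n : ℕ} (A : Fin n → Fin n → ℂ) : Matrix (Fin n) (Fin n) ℂ :=
  Matrix.of fun i j => (A i j + star (A j i)) / 2

lemma isHermitian_hermitianPart {n : ℕ} (A : Fin n → Fin n → ℂ) :
    (hermitianPart A).IsHermitian := by
  ext i j
  simp [hermitianPart, add_comm]

lemma hermitianPart_eq_self {n : ℕ} {A : Matrix (Fin n) (Fin n) ℂ} (hA : A.IsHermitian) :
    hermitianPart (fun i j => A i j) = A := by
  ext i j
  rw [hermitianPart, Matrix.of_apply, hA.apply]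
  ring

/-- Passing to the Hermitian part makes the perturbed spectrum a function on all arrays, as needed
to integrate against the joint law of the matrix and the vector. -/
lemma measurable_eigenvalues_rankOneModification_hermitianPart {n : ℕ} :
    Measurable fun p : (Fin n → Fin n → ℂ) × (Fin n → ℂ) =>
      (isHermitian_rankOneModification (isHermitian_hermitianPart p.1) p.2).eigenvalues := by
  refine measurable_eigenvalues _ fun i j => ?_
  have h1 : ∀ i j, Measurable fun p : (Fin n → Fin n → ℂ) × (Fin n → ℂ) => p.1 i j :=
    fun i j => (measurable_pi_apply j).comp ((measurable_pi_apply i).comp measurable_fst)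
  have h2 : ∀ i, Measurable fun p : (Fin n → Fin n → ℂ) × (Fin n → ℂ) => p.2 i :=
    fun i => (measurable_pi_apply i).comp measurable_snd
  have hc : Measurable (star : ℂ → ℂ) := Complex.continuous_conj.measurable
  exact (((h1 i j).add (hc.comp (h1 j i))).div_const 2).add ((h2 i).mul (hc.comp (h2 j)))

lemma lintegral_unorderedEigenvalueLaw {Ω : Type*} [MeasurableSpace Ω] (μ : Measure Ω) {n : ℕ}
    {M : Ω → Matrix (Fin n) (Fin n) ℂ} (hM : ∀ ω, (M ω).IsHermitian)
    (hmeas : Measurable fun ω => (hM ω).eigenvalues) {φ : (Fin n → ℝ) → ℝ≥0∞}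
    (hφ : Measurable φ) :
    ∫⁻ x, φ x ∂(unorderedEigenvalueLaw μ M hM) =
      ∫⁻ ω, symmetrization φ (hM ω).eigenvalues ∂μ := by
  rw [unorderedEigenvalueLaw, lintegral_symmetrizedLaw _ hφ,
    lintegral_map (measurable_symmetrization hφ) hmeas]

/-- Having a repeated coordinate is a permutation-invariant null event, so its probability is the
same for the ordered and the unordered eigenvalues. -/
lemma ae_injective_eigenvalues {Ω : Type*} [MeasurableSpace Ω] {μ : Measure Ω} {n : ℕ}
    {M : Ω → Matrix (Fin n) (Fin n) ℂ} {hM : ∀ ω, (M ω).IsHermitian}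
    (hmeas : Measurable fun ω => (hM ω).eigenvalues)
    (hac : unorderedEigenvalueLaw μ M hM ≪ volume) :
    ∀ᵐ ω ∂μ, Function.Injective (hM ω).eigenvalues := by
  let N : Set (Fin n → ℝ) := {x | vandermondeProd x = 0}
  have hN : MeasurableSet N := measurable_vandermondeProd (measurableSet_singleton 0)
  have hmemN : ∀ x, x ∈ N ↔ ¬ Function.Injective x := fun x =>
    (not_iff_comm.1 vandermondeProd_ne_zero_iff).symm
  have hφ : Measurable (N.indicator fun _ => (1 : ℝ≥0∞)) := measurable_const.indicator hN
  have hsymm : ∀ (x : Fin n → ℝ) (σ : Equiv.Perm (Fin n)),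
      N.indicator (fun _ => (1 : ℝ≥0∞)) (x ∘ σ) = N.indicator (fun _ => 1) x := fun x σ => by
    have : x ∘ σ ∈ N ↔ x ∈ N := by
      rw [hmemN, hmemN, Equiv.injective_comp]
    by_cases h : x ∈ N
    · rw [Set.indicator_of_mem h, Set.indicator_of_mem (this.2 h)]
    · rw [Set.indicator_of_notMem h, Set.indicator_of_notMem (mt this.1 h)]
  have h := lintegral_unorderedEigenvalueLaw μ hM hmeas hφ
  have h0 : unorderedEigenvalueLaw μ M hM N = 0 := by
    refine hac ?_
    have := ae_injective n
    rw [ae_iff] at this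
    refine measure_mono_null (fun x hx => ?_) this
    exact (hmemN x).1 hx
  rw [lintegral_indicator_const hN, h0, mul_zero] at h
  simp only [symmetrization_eq_self hsymm] at h
  have h' := (lintegral_eq_zero_iff (hφ.comp hmeas)).1 h.symm
  filter_upwards [h'] with ω hω
  by_contra hinj
  have : (hM ω).eigenvalues ∈ N := (hmemN _).2 hinj
  simp [Set.indicator_of_mem this] at hω

/-- The average of `φ` over the eigenvalues of the rank one modification, given the eigenvalues
`x` of the original matrix. -/
def transitionAverage {n : ℕ} (φ : (Fin n → ℝ) → ℝ≥0∞) (x : Fin n → ℝ) : ℝ≥0∞ :=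
  (n.factorial : ℝ≥0∞)⁻¹ * ∫⁻ y, φ y * ENNReal.ofReal (transitionDensity x y)

lemma measurable_transitionAverage {n : ℕ} {φ : (Fin n → ℝ) → ℝ≥0∞} (hφ : Measurable φ) :
    Measurable (transitionAverage φ) :=
  (Measurable.lintegral_prod_right' (f := fun p : (Fin n → ℝ) × (Fin n → ℝ) =>
    φ p.2 * ENNReal.ofReal (transitionDensity p.1 p.2)) ((hφ.comp measurable_snd).mul
      measurable_transitionDensity.ennreal_ofReal)).const_mul _

lemma transitionAverage_comp_perm {n : ℕ} (φ : (Fin n → ℝ) → ℝ≥0∞) (x : Fin n → ℝ)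
    (σ : Equiv.Perm (Fin n)) : transitionAverage φ (x ∘ σ) = transitionAverage φ x := by
  simp only [transitionAverage, transitionDensity_comp_left]

lemma IsPolynomialEnsemble.lintegral_mul_transitionAverage {n : ℕ} {f : Fin n → ℝ → ℝ} {Z : ℝ}
    (hf : IsPolynomialEnsemble f Z) {φ : (Fin n → ℝ) → ℝ≥0∞} (hφ : Measurable φ) :
    ∫⁻ x, ENNReal.ofReal (polyEnsembleDensity f Z x) * transitionAverage φ x =
      ∫⁻ y, ENNReal.ofReal (polyEnsembleDensity (fun k => expConvolution (f k)) Z y) * φ y := by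
  have hfact : (n.factorial : ℝ≥0∞) ≠ 0 := by exact_mod_cast n.factorial_ne_zero
  have hρ := (aemeasurable_polyEnsembleDensity hf.integrable Z).ennreal_ofReal
  have hswap : AEMeasurable (Function.uncurry fun x y : Fin n → ℝ =>
      ENNReal.ofReal (polyEnsembleDensity f Z x) *
        (φ y * ENNReal.ofReal (transitionDensity x y))) (volume.prod volume) :=
    hρ.comp_fst.mul ((hφ.comp measurable_snd).mul
      measurable_transitionDensity.ennreal_ofReal).aemeasurable
  have hT : ∀ y, AEMeasurable fun x : Fin n → ℝ => ENNReal.ofReal (transitionDensity x y) :=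
    fun y => (measurable_transitionDensity.comp
      (measurable_id.prodMk measurable_const)).ennreal_ofReal.aemeasurable
  calc ∫⁻ x, ENNReal.ofReal (polyEnsembleDensity f Z x) * transitionAverage φ x
      = ∫⁻ x, (n.factorial : ℝ≥0∞)⁻¹ * ∫⁻ y, ENNReal.ofReal (polyEnsembleDensity f Z x) *
          (φ y * ENNReal.ofReal (transitionDensity x y)) := by
        refine lintegral_congr fun x => ?_
        rw [transitionAverage, lintegral_const_mul' _ _ ENNReal.ofReal_ne_top, mul_left_comm]
    _ = (n.factorial : ℝ≥0∞)⁻¹ * ∫⁻ y, ∫⁻ x, ENNReal.ofReal (polyEnsembleDensity f Z x) *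
          (φ y * ENNReal.ofReal (transitionDensity x y)) := by
        rw [lintegral_const_mul' _ _ (ENNReal.inv_ne_top.2 hfact), lintegral_lintegral_swap hswap]
    _ = (n.factorial : ℝ≥0∞)⁻¹ * ∫⁻ y, (n.factorial : ℝ≥0∞) *
          (ENNReal.ofReal (polyEnsembleDensity (fun k => expConvolution (f k)) Z y) * φ y) := by
        congr 1
        refine lintegral_congr fun y => ?_
        rw [← mul_assoc, ← hf.lintegral_transitionDensity_mul, mul_comm _ (φ y),
          ← lintegral_const_mul'' (f := fun x => ENNReal.ofReal (polyEnsembleDensity f Z x) *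
            ENNReal.ofReal (transitionDensity x y)) _ (hρ.mul (hT y))]
        exact lintegral_congr fun x => by ring
    _ = ∫⁻ y, ENNReal.ofReal (polyEnsembleDensity (fun k => expConvolution (f k)) Z y) * φ y := by
        rw [lintegral_const_mul' _ _ (ENNReal.natCast_ne_top _), ← mul_assoc,
          ENNReal.inv_mul_cancel hfact (ENNReal.natCast_ne_top _), one_mul]

lemma measurable_eigenvalues_of_measurable {Ω : Type*} [MeasurableSpace Ω] {n : ℕ}
    {X : Ω → Matrix (Fin n) (Fin n) ℂ} (hXmeas : Measurable (fun (ω : Ω) (i j : Fin n) => X ω i j))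
    (hX : ∀ ω, (X ω).IsHermitian) : Measurable fun ω => (hX ω).eigenvalues :=
  measurable_eigenvalues hX fun i j =>
    (measurable_pi_apply j).comp ((measurable_pi_apply i).comp hXmeas)

lemma measurable_eigenvalues_rankOneModification {Ω : Type*} [MeasurableSpace Ω] {n : ℕ}
    {X : Ω → Matrix (Fin n) (Fin n) ℂ} (hXmeas : Measurable (fun (ω : Ω) (i j : Fin n) => X ω i j))
    (hX : ∀ ω, (X ω).IsHermitian) {v : Ω → Fin n → ℂ} (hv : Measurable v) :
    Measurable fun ω => (isHermitian_rankOneModification (hX ω) (v ω)).eigenvalues :=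
  measurable_eigenvalues _ fun i j => by
    have hX' : Measurable fun ω => X ω i j :=
      (measurable_pi_apply j).comp ((measurable_pi_apply i).comp hXmeas)
    exact hX'.add (((measurable_pi_apply i).comp hv).mul
      (Complex.continuous_conj.measurable.comp ((measurable_pi_apply j).comp hv)))

/-- Independence and Tonelli allow v to be integrated first with the matrix fixed. The resulting
average is symmetric in the old eigenvalues, hence may be integrated against their unordered law. -/
lemma lintegral_unorderedEigenvalueLaw_rankOneModification {Ω : Type*} [MeasurableSpace Ω]
    {μ : Measure Ω} [IsProbabilityMeasure μ] {n : ℕ} {v : Ω → Fin n → ℂ} (hv : Measurable v)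
    (hlaw : μ.map v = complexGaussianVector n) {X : Ω → Matrix (Fin n) (Fin n) ℂ}
    (hXmeas : Measurable (fun (ω : Ω) (i j : Fin n) => X ω i j))
    (hX : ∀ ω, (X ω).IsHermitian)
    (hXv : IndepFun (fun (ω : Ω) (i j : Fin n) => X ω i j) v μ)
    (hac : unorderedEigenvalueLaw μ X hX ≪ volume) {φ : (Fin n → ℝ) → ℝ≥0∞}
    (hφ : Measurable φ) :
    ∫⁻ y, φ y ∂(unorderedEigenvalueLaw μ (fun ω => rankOneModification (X ω) (v ω))
        (fun ω => isHermitian_rankOneModification (hX ω) (v ω))) =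
      ∫⁻ x, transitionAverage φ x ∂(unorderedEigenvalueLaw μ X hX) := by
  have heX := measurable_eigenvalues_of_measurable hXmeas hX
  let Φ : (Fin n → Fin n → ℂ) × (Fin n → ℂ) → ℝ≥0∞ := fun p => symmetrization φ
    (isHermitian_rankOneModification (isHermitian_hermitianPart p.1) p.2).eigenvalues
  have hΦ : Measurable Φ := (measurable_symmetrization hφ).comp
    measurable_eigenvalues_rankOneModification_hermitianPart
  have heig : ∀ ω (u : Fin n → ℂ), (isHermitian_rankOneModification
      (isHermitian_hermitianPart fun i j => X ω i j) u).eigenvalues =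
        (isHermitian_rankOneModification (hX ω) u).eigenvalues := fun ω u => by
    rw [Matrix.IsHermitian.eigenvalues_eq_eigenvalues_iff, hermitianPart_eq_self (hX ω)]
  have hXvm := hXmeas.prodMk hv
  have heY := measurable_eigenvalues_rankOneModification hXmeas hX hv
  rw [lintegral_unorderedEigenvalueLaw μ _ heY hφ,
    lintegral_unorderedEigenvalueLaw μ hX heX (measurable_transitionAverage hφ)]
  simp only [symmetrization_eq_self (transitionAverage_comp_perm φ)]
  calc ∫⁻ ω, symmetrization φ (isHermitian_rankOneModification (hX ω) (v ω)).eigenvalues ∂μ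
      = ∫⁻ p, Φ p ∂(μ.map fun ω => ((fun i j => X ω i j), v ω)) := by
        rw [lintegral_map hΦ hXvm]
        exact lintegral_congr fun ω => by simp only [Φ, heig]
    _ = ∫⁻ A, ∫⁻ u, Φ (A, u) ∂(complexGaussianVector n) ∂(μ.map fun ω i j => X ω i j) := by
        rw [(indepFun_iff_map_prod_eq_prod_map_map hXmeas.aemeasurable hv.aemeasurable).1 hXv,
          hlaw, lintegral_prod _ hΦ.aemeasurable]
    _ = ∫⁻ ω, transitionAverage φ (hX ω).eigenvalues ∂μ := by
        rw [lintegral_map hΦ.lintegral_prod_right' hXmeas]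
        refine lintegral_congr_ae ?_
        filter_upwards [ae_injective_eigenvalues heX hac] with ω hω
        simp only [Φ, heig]
        exact lintegral_eigenvalues_rankOneModification (hX ω) hω hφ

end

theorem proposition5p1 {Ω : Type*} [MeasurableSpace Ω] (μ : Measure Ω) [IsProbabilityMeasure μ]
    (n : ℕ)
    (v : Ω → Fin n → ℂ) (hv : Measurable v)
    (hre : ∀ j, HasLaw (fun ω => (v ω j).re) (gaussianReal 0 (1 / 2)) μ)
    (him : ∀ j, HasLaw (fun ω => (v ω j).im) (gaussianReal 0 (1 / 2)) μ)
    (hindep : iIndepFun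
      (Sum.elim (fun (j : Fin n) (ω : Ω) => (v ω j).re) (fun (j : Fin n) (ω : Ω) => (v ω j).im)) μ)
    (X : Ω → Matrix (Fin n) (Fin n) ℂ)
    (hXmeas : Measurable (fun (ω : Ω) (i j : Fin n) => X ω i j))
    (hX : ∀ ω, (X ω).IsHermitian)
    (hXv : IndepFun (fun (ω : Ω) (i j : Fin n) => X ω i j) v μ)
    (f : Fin n → ℝ → ℝ)
    (hf : EigenvaluesArePolynomialEnsemble μ X hX f) :
    (∀ (k : Fin n) (y : ℝ),
      IntegrableOn (fun x : ℝ => Real.exp (-x) * f k (y - x)) (Set.Ioi 0)) ∧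
    EigenvaluesArePolynomialEnsemble μ
      (fun ω => rankOneModification (X ω) (v ω))
      (fun ω => isHermitian_rankOneModification (hX ω) (v ω))
      (fun k y => ∫ x in Set.Ioi (0 : ℝ), Real.exp (-x) * f k (y - x)) := by
  obtain ⟨Z, hfZ, hlaw⟩ := hf
  -- The constant `Z` is unchanged: the n! from Andréief's identity cancels the 1/n! of the
  -- transition density.
  refine ⟨fun k y => integrableOn_exp_neg_mul (hfZ.integrable k) y, Z, ?_⟩
  have hg : (fun k y => ∫ x in Set.Ioi (0 : ℝ), Real.exp (-x) * f k (y - x)) =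
      fun k => expConvolution (f k) := funext fun k => funext fun y => integral_exp_neg_mul _ _
  rw [hg]
  have hmoment : ∀ j k : Fin n, Integrable fun y => y ^ (j : ℕ) * expConvolution (f k) y :=
    fun j k => integrable_pow_mul_expConvolution fun i hi =>
      hfZ.integrable_moment ⟨i, hi.trans_lt j.2⟩ k
  have hgint : ∀ k, Integrable (expConvolution (f k)) := fun k => by
    simpa using hmoment ⟨0, k.pos⟩ k
  have hρf := (aemeasurable_polyEnsembleDensity hfZ.integrable Z).ennreal_ofReal
  have hρg := (aemeasurable_polyEnsembleDensity hgint Z).ennreal_ofReal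
  have hac : unorderedEigenvalueLaw μ X hX ≪ volume := by
    rw [hlaw]
    exact withDensity_absolutelyContinuous _ _
  have hY : unorderedEigenvalueLaw μ (fun ω => rankOneModification (X ω) (v ω))
      (fun ω => isHermitian_rankOneModification (hX ω) (v ω)) =
      volume.withDensity fun y =>
        ENNReal.ofReal (polyEnsembleDensity (fun k => expConvolution (f k)) Z y) := by
    refine Measure.ext_of_lintegral _ fun φ hφ => ?_
    rw [lintegral_unorderedEigenvalueLaw_rankOneModification hv
      (map_eq_complexGaussianVector hv hre him hindep) hXmeas hX hXv hac hφ, hlaw,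
      lintegral_withDensity_eq_lintegral_mul₀ hρf (measurable_transitionAverage hφ).aemeasurable,
      lintegral_withDensity_eq_lintegral_mul₀ hρg hφ.aemeasurable]
    exact hfZ.lintegral_mul_transitionAverage hφ
  refine ⟨⟨hmoment, hfZ.expConvolution_nonneg, ?_⟩, hY⟩
  -- The symmetrization of the constant 1 does not depend on the matrix, so the unordered laws for
  -- `X` and `Y` have the same mass; this gives the normalisation without evaluating an integral.
  have h1 : ∫⁻ _, 1 ∂(unorderedEigenvalueLaw μ X hX) = 1 := by
    rw [lintegral_one, hlaw, withDensity_apply _ .univ, Measure.restrict_univ,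
      hfZ.lintegral_eq_one]
  have heX := measurable_eigenvalues_of_measurable hXmeas hX
  have heY := measurable_eigenvalues_rankOneModification hXmeas hX hv
  have h2 : ∫⁻ _, 1 ∂(unorderedEigenvalueLaw μ (fun ω => rankOneModification (X ω) (v ω))
      (fun ω => isHermitian_rankOneModification (hX ω) (v ω))) = 1 := by
    rw [lintegral_unorderedEigenvalueLaw μ _ heY measurable_const]
    rw [lintegral_unorderedEigenvalueLaw μ _ heX measurable_const] at h1
    simpa only [symmetrization] using h1
  rwa [lintegral_one, hY, withDensity_apply _ .univ, Measure.restrict_univ] at h2
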